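/- Let $K$ be a global field, that is, a number field or a finite extension of $\mathbb{F}_p(t)$ for a prime $p$. Let $M_K$ be the standard set of absolute values on $K$: if $K$ is a number field, those whose restriction to $\mathbb{Q}$ is the usual or a $p$-adic absolute value, with local degree $n_v=[K_v:\mathbb{Q}_v]/[K:\mathbb{Q}]$; if $K$ is a function field, the absolute values $|x|_v=e^{-v(x)}$ with $v$ a discrete valuation of $K$ with value group $\mathbb{Z}$ and residue field $k_v$, with local degree $n_v=[k_v:\mathbb{F}_p]$. Here $K_v$ is the completion of $K$ at $v$. Let $\|(x,y)\|_v=\max\{|x|_v,|y|_v\}$ and let $h([x,y])=\sum_{v\in M_K}n_v\log\|(x,y)\|_v$ be the Weil height on $\mathbb{P}^1(K)$. Let $S$ be a finite set of endomorphisms of $\mathbb{P}^1$ over $K$, all of degree at least $2$, and let $\nu_1$ be a probability measure on $S$. Let $\Phi_S=\prod_{n\ge1}S$ with the product probability measure $\nu$ (i.i.d. sequences with law $\nu_1$). For $\gamma=(\theta_n)_{n\ge1}\in\Phi_S$ put $\gamma_n=\theta_n\circ\dots\circ\theta_1$ and $\deg\gamma_n=\prod_{i\le n}\deg\theta_i$,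 and let $$\hat h_\gamma(P)=\lim_{n\to\infty}\frac{h(\gamma_n(P))}{\deg\gamma_n},\qquad \mathbb{E}_\nu[\hat h](P)=\int_{\Phi_S}\hat h_\gamma(P)\,d\nu(\gamma).$$ Fix for each $\phi\in S$ a lift $\tilde\phi:\mathbb{A}^2\to\mathbb{A}^2$ over $K$, given by two binary forms of degree $\deg\phi$ without common zero in $\overline K{}^2\setminus\{0\}$, and put $\tilde\gamma_n=\tilde\theta_n\circ\dots\circ\tilde\theta_1$. Let $E\in K[x,y]$ be homogeneous of degree $e$. For $v\in M_K$ and $[x,y]\in\mathbb{P}^1(K_v)$ with $E(x,y)\ne0$ let $$\mathcal{G}_{v,\tilde\gamma}(x,y)=\lim_{n\to\infty}\frac{\log\|\tilde\gamma_n(x,y)\|_v}{\deg\gamma_n},\qquad \hat\lambda_{v,\tilde\gamma,E}([x,y])=e\,\mathcal{G}_{v,\tilde\gamma}(x,y)-\log|E(x,y)|_v .$$ Then: (1) For all $v\in M_K$ and all $P\in\mathbb{P}^1(K_v)\setminus\{E=0\}$, the local expected canonical height $$\mathbb{E}_\nu[\hat\lambda_{v,\tilde\gamma,E}](P)=\int_{\Phi_S}\hat\lambda_{v,\tilde\gamma,E}(P)\,d\nu(\gamma)$$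 is well defined: for every $\gamma\in\Phi_S$ the limit defining $\mathcal{G}_{v,\tilde\gamma}$ exists and is finite and $\hat\lambda_{v,\tilde\gamma,E}(P)$ does not depend on the representative of $P$, and $\gamma\mapsto\hat\lambda_{v,\tilde\gamma,E}(P)$ is $\nu$-integrable. (2) If $e\ge1$, then for all $P\in\mathbb{P}^1(K)\setminus\{E=0\}$ the limit $\hat h_\gamma(P)$ exists for every $\gamma\in\Phi_S$, the function $\gamma\mapsto\hat h_\gamma(P)$ is $\nu$-integrable, and $$\mathbb{E}_\nu[\hat h](P)=\frac1{e}\sum_{v\in M_K}n_v\,\mathbb{E}_\nu[\hat\lambda_{v,\tilde\gamma,E}](P),$$ where only finitely many terms of the sum are nonzero. -/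

import Mathlib

open MeasureTheory Filter

open scoped LinearAlgebra.Projectivization

namespace StochasticHeight

noncomputable section

/-! ### Global fields, their places and local degrees -/

/-- A global field: a number field, or a finite extension of `𝔽_p(t)` for some prime `p`. -/
def IsGlobalField (K : Type*) [Field K] : Prop :=
  NumberField K ∨
    ∃ (p : ℕ) (_ : Fact p.Prime) (_ : Algebra (RatFunc (ZMod p)) K),
      FiniteDimensional (RatFunc (ZMod p)) K

/-- The standard absolute values on `ℚ`: the real one and the `p`-adic ones (with `|p| = 1/p`). -/
def standardRat : Set (AbsoluteValue ℚ ℝ) :=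
  {w | w = Rat.AbsoluteValue.real ∨ ∃ (p : ℕ) (_ : Fact p.Prime), w = Rat.AbsoluteValue.padic p}

/-- The standard set `M_K` of absolute values on a global field `K`, one for each place.
If `K` is a number field, these are the absolute values that restrict to a standard absolute
value on `ℚ`.  If `K` is a function field, these are the absolute values `x ↦ exp (- ord_v x)`
where `ord_v` is a discrete valuation with value group exactly `ℤ`. -/
def places (K : Type*) [Field K] : Set (AbsoluteValue K ℝ) :=
  {v | (CharZero K ∧ ∃ w ∈ standardRat, ∀ q : ℚ, v (q : K) = w q) ∨
    (¬ CharZero K ∧ v '' {x | x ≠ 0} = Set.range fun n : ℤ ↦ Real.exp n)}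

/-- The valuation ring `{x | |x|_v ≤ 1}` of a nonarchimedean absolute value. -/
def valuationRing {K : Type*} [Field K] (v : AbsoluteValue K ℝ) (hv : IsNonarchimedean v) :
    ValuationSubring K where
  carrier := {x | v x ≤ 1}
  mul_mem' {a b} ha hb := by
    simp only [Set.mem_ofPred_eq, map_mul] at *
    exact mul_le_one₀ ha (v.nonneg b) hb
  one_mem' := by simp
  add_mem' {a b} ha hb := (hv a b).trans (max_le ha hb)
  zero_mem' := by simp
  neg_mem' {a} ha := by simpa using ha
  mem_or_inv_mem' a := by
    rcases le_total (v a) 1 with h | h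
    · exact Or.inl h
    · refine Or.inr ?_
      simp only [Set.mem_ofPred_eq, map_inv₀]
      exact inv_le_one_of_one_le₀ h

open Classical in
/-- The degree over the prime field of the residue field of a nonarchimedean absolute value
(`⊥ : Subfield k` is the prime field of `k`); it is `0` by convention for the others. -/
def residueDegree {K : Type*} [Field K] (v : AbsoluteValue K ℝ) : ℕ :=
  if hv : IsNonarchimedean v then
    Module.finrank (⊥ : Subfield (IsLocalRing.ResidueField (valuationRing v hv)))
      (IsLocalRing.ResidueField (valuationRing v hv))
  else 0

/-- The canonical embedding of `K` into its completion `K_v`. -/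
def embed {K : Type*} [Field K] (v : AbsoluteValue K ℝ) : K →+* v.Completion :=
  UniformSpace.Completion.coeRingHom.comp (WithAbs.equiv v).symm.toRingHom

open Classical in
/-- The local degree `n_v`.  For a number field it is `[K_v : ℚ_v] / [K : ℚ]`, where `ℚ_v` is the
closure in `K_v` of the prime field `ℚ`.  For a function field it is the degree `[k_v : 𝔽_p]`
of the residue field. -/
def localDegree {K : Type*} [Field K] (v : AbsoluteValue K ℝ) : ℝ :=
  if CharZero K then
    (Module.finrank (⊥ : Subfield v.Completion).topologicalClosure v.Completion : ℝ) /
      (Module.finrank (⊥ : Subfield K) K : ℝ)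
  else (residueDegree v : ℝ)

/-! ### The projective line, its endomorphisms and their lifts -/

/-- The projective line over a field. -/
abbrev P1 (K : Type*) [Field K] : Type _ := ℙ K (Fin 2 → K)

/-- The map `ℙ¹(K) → ℙ¹(L)` induced by a field embedding `K → L`. -/
def P1.baseChange {K L : Type*} [Field K] [Field L] (σ : K →+* L) : P1 K → P1 L :=
  Projectivization.map
    ({ toFun := fun x i ↦ σ (x i)
       map_add' := fun x y ↦ by ext i; simp
       map_smul' := fun c x ↦ by ext i; simp } : (Fin 2 → K) →ₛₗ[σ] (Fin 2 → L))
    (fun x y h ↦ by ext i; exact σ.injective (congrFun h i))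

/-- A map `𝔸² → 𝔸²` over `K` that lifts an endomorphism of `ℙ¹` of degree `degree`: a pair of
binary forms of that degree which have no common zero over the algebraic closure except `0`. -/
structure Lift (K : Type*) [Field K] where
  degree : ℕ
  poly : Fin 2 → MvPolynomial (Fin 2) K
  isHomogeneous : ∀ i, (poly i).IsHomogeneous degree
  eq_zero_of_eval_eq_zero : ∀ x : Fin 2 → AlgebraicClosure K,
    (∀ i, (poly i).eval₂ (algebraMap K (AlgebraicClosure K)) x = 0) → x = 0

/-- Evaluation of a lift at a point of `𝔸²(L)`, for a ring homomorphism `σ : K → L`. -/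
def Lift.eval {K L : Type*} [Field K] [CommRing L] (F : Lift K) (σ : K →+* L) (x : Fin 2 → L) :
    Fin 2 → L :=
  fun i ↦ (F.poly i).eval₂ σ x

/-- `F` is a lift of the map `φ` of the projective line: `φ [x, y] = [F (x, y)]`. -/
def Lift.Induces {K : Type*} [Field K] (F : Lift K) (φ : P1 K → P1 K) : Prop :=
  ∀ (x : Fin 2 → K) (hx : x ≠ 0), ∃ h : F.eval (RingHom.id K) x ≠ 0,
    φ (Projectivization.mk K x hx) = Projectivization.mk K (F.eval (RingHom.id K) x) h

/-- An endomorphism of `ℙ¹` over the (infinite) field `K` together with its degree.  Since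
`ℙ¹(K)` is dense in `ℙ¹`, the endomorphism is recorded by its action on `ℙ¹(K)`. -/
@[ext] structure Endomorphism (K : Type*) [Field K] where
  toFun : P1 K → P1 K
  degree : ℕ
  exists_lift : ∃ F : Lift K, F.degree = degree ∧ F.Induces toFun

/-- `F` is a lift of the endomorphism `φ`. -/
def Lift.IsLiftOf {K : Type*} [Field K] (F : Lift K) (φ : Endomorphism K) : Prop :=
  F.degree = φ.degree ∧ F.Induces φ.toFun

/-! ### Canonical heights along a sequence of maps -/

/-- The Weil height on `ℙ¹(K)`: `h([x, y]) = ∑ᵥ nᵥ log max(|x|ᵥ, |y|ᵥ)`. -/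
def weilHeight {K : Type*} [Field K] (P : P1 K) : ℝ :=
  ∑ᶠ v : places K, localDegree v.1 * Real.log (max (v.1 (P.rep 0)) (v.1 (P.rep 1)))

/-- `γ_n · P = (θ_n ∘ ⋯ ∘ θ_1)(P)`, where `θ_{i+1} = γ i`. -/
def orbit {K : Type*} [Field K] (γ : ℕ → Endomorphism K) (P : P1 K) : ℕ → P1 K
  | 0 => P
  | n + 1 => (γ n).toFun (orbit γ P n)

/-- The sequence `h(γ_n · P) / deg γ_n`. -/
def heightSeq {K : Type*} [Field K] (γ : ℕ → Endomorphism K) (P : P1 K) (n : ℕ) : ℝ :=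
  weilHeight (orbit γ P n) / ((∏ i ∈ Finset.range n, (γ i).degree : ℕ) : ℝ)

/-- The canonical height `ĥ_γ(P) = lim h(γ_n · P) / deg γ_n`. -/
def canonicalHeight {K : Type*} [Field K] (γ : ℕ → Endomorphism K) (P : P1 K) : ℝ :=
  limUnder atTop (heightSeq γ P)

/-- `γ̃_n(z)` for a sequence `Γ` of lifts and a point `z` of `𝔸²(K_v)`. -/
def liftOrbit {K : Type*} [Field K] (v : AbsoluteValue K ℝ) (Γ : ℕ → Lift K)
    (z : Fin 2 → v.Completion) : ℕ → (Fin 2 → v.Completion)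
  | 0 => z
  | n + 1 => (Γ n).eval (embed v) (liftOrbit v Γ z n)

/-- The sequence `log ‖γ̃_n(z)‖_v / deg γ̃_n`, with `‖·‖_v` the sup norm on `𝔸²(K_v)`. -/
def greenSeq {K : Type*} [Field K] (v : AbsoluteValue K ℝ) (Γ : ℕ → Lift K)
    (z : Fin 2 → v.Completion) (n : ℕ) : ℝ :=
  Real.log ‖liftOrbit v Γ z n‖ / ((∏ i ∈ Finset.range n, (Γ i).degree : ℕ) : ℝ)

/-- The Green function of a sequence of lifts at `v`. -/
def green {K : Type*} [Field K] (v : AbsoluteValue K ℝ) (Γ : ℕ → Lift K)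
    (z : Fin 2 → v.Completion) : ℝ :=
  limUnder atTop (greenSeq v Γ z)

/-- The expression `e G_v(z) - log |E(z)|_v` for `z` in `𝔸²(K_v)`, `E` a form of degree `e`. -/
def localHeightAt {K : Type*} [Field K] (v : AbsoluteValue K ℝ) (Γ : ℕ → Lift K) (e : ℕ)
    (E : MvPolynomial (Fin 2) K) (z : Fin 2 → v.Completion) : ℝ :=
  e * green v Γ z - Real.log ‖E.eval₂ (embed v) z‖

/-- The local canonical height at a point of `ℙ¹(K_v)`, computed at some representative. -/
def localHeight {K : Type*} [Field K] (v : AbsoluteValue K ℝ) (Γ : ℕ → Lift K) (e : ℕ)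
    (E : MvPolynomial (Fin 2) K) (P : P1 v.Completion) : ℝ :=
  localHeightAt v Γ e E P.rep

/-! ### Expected heights -/

/-- The law of an i.i.d. sequence of elements of `S` with distribution `ν₁`. -/
def iid {S : Type*} [MeasurableSpace S] (ν₁ : Measure S) [IsProbabilityMeasure ν₁] :
    Measure (ℕ → S) :=
  Measure.infinitePi fun _ ↦ ν₁

/-- The expected canonical height of `P`. -/
def expectedHeight {K : Type*} [Field K] {S : Set (Endomorphism K)} [MeasurableSpace S]
    (ν₁ : Measure S) [IsProbabilityMeasure ν₁] (P : P1 K) : ℝ :=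
  ∫ γ, canonicalHeight (fun n ↦ (γ n : Endomorphism K)) P ∂iid ν₁

/-- The local expected canonical height of a point of `ℙ¹(K_v)`, for the lifts `F φ` of the
elements `φ` of `S` and the form `E` of degree `e`. -/
def expectedLocalHeight {K : Type*} [Field K] {S : Set (Endomorphism K)} [MeasurableSpace S]
    (ν₁ : Measure S) [IsProbabilityMeasure ν₁] (F : S → Lift K) (e : ℕ)
    (E : MvPolynomial (Fin 2) K) (v : AbsoluteValue K ℝ) (P : P1 v.Completion) : ℝ :=
  ∫ γ, localHeight v (fun n ↦ F (γ n)) e E P ∂iid ν₁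

end

end StochasticHeight

open StochasticHeight

/-!
Three facts carry the proof.

*Lifts scale sizes.* By the homogeneous Nullstellensatz, high powers of the coordinates are
combinations of the two forms of a lift `F` of degree `d`, so at every absolute value
`log ‖F z‖ = d * log ‖z‖ + O(1)` (`Lift.exists_abs_log_norm_eval_sub_le`), and the error vanishes
where the absolute value is ultrametric and finitely many coefficients are integral
(`Lift.exists_finset_norm_eval_eq`). Since all degrees are at least `2` and `S` is finite, the
sequence defining the Green function converges geometrically, uniformly over all random sequences.
Its terms depend on finitely many coordinates of the random sequence, so the Green function is
measurable; it stays within a constant of `log ‖z‖`, so it is integrable (`integrable_green`). Under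
scaling by `c` it grows by `log ‖c‖`, which is why `e * G - log |E|` is a function on the projective
line.

*Global heights are finite sums of local ones.* By the product formula the Weil height can be
computed at any representative (`weilHeight_mk`). A representative of `P` and the finitely many
lifts in `S` are good outside a finite set of places, the same for all random sequences, and the
height along the orbit is the sum over this set of the terms of the Green sequences, weighted by the
local degrees (`heightSeq_eq_sum`). Limits and integrals of finite sums can be taken termwise, and
the product formula for the value of `E` at the representative removes the terms `log |E|_v`
(`expectedHeight_eq_of_hasProductFormula`).

*Global fields satisfy the product formula* for the given places and local degrees
(`HasProductFormula`).
For a function field, a transcendental `x` has as many zeros, counted with multiplicity and residue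
degree, as the degree `[K : 𝔽_p(x)]`: both numbers are the logarithm to base `p` of the index of the
ideal `(x)` in the integral closure of `𝔽_p[x]`, a Dedekind domain which is free of that rank over
`𝔽_p[x]`, also when the extension is inseparable (`finite_integralClosure`). As `x` and `x⁻¹`
generate the same subfield, `x` has as many poles as zeros (`hasProductFormula_of_ratFunc`).
For a number field, the absolute values extending the real one are the infinite places, by weak
approximation (`exists_infinitePlace_eq`), and those extending a `p`-adic one belong to primes of
`𝓞 K`; their local degree is found from a basis of the integers modulo `p`, which is a basis
of the completion over the closure of `ℚ` (`IsBasisModP.finrank_eq`). This reduces the claim to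
`NumberField.prod_abs_eq_one` (`hasProductFormula_of_numberField`).
-/

namespace StochasticHeight

/-! ### Lifts and the Nullstellensatz -/

/-- A form `p` of degree `d` times any polynomial has homogeneous components that are multiples
of `p`. -/
lemma homogeneousComponent_mul_of_isHomogeneous {k : Type*} [Field k]
    (q : MvPolynomial (Fin 2) k) {p : MvPolynomial (Fin 2) k} {d : ℕ} (hp : p.IsHomogeneous d)
    (m : ℕ) :
    MvPolynomial.homogeneousComponent (m + d) (q * p) =
      MvPolynomial.homogeneousComponent m q * p := by
  let := MvPolynomial.gradedAlgebra (σ := Fin 2) (R := k)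
  have h := DirectSum.coe_decompose_mul_add_of_right_mem
    (MvPolynomial.homogeneousSubmodule (Fin 2) k) (i := m) (j := d) (a := q) (b := p)
    ((MvPolynomial.mem_homogeneousSubmodule _ _).2 hp)
  rw [← MvPolynomial.decomposition.decompose'_apply,
    ← MvPolynomial.decomposition.decompose'_apply]
  exact h

/-- The homogeneous Nullstellensatz for a lift: high powers of the coordinates are combinations
of the two forms, with coefficients that are forms over the base field. -/
lemma Lift.exists_sum_mul_eq_X_pow {K : Type*} [Field K] (F : Lift K) :
    ∃ (m : ℕ) (A : Fin 2 → Fin 2 → MvPolynomial (Fin 2) K),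
      (∀ i j, (A i j).IsHomogeneous m) ∧
      ∀ i, ∑ j, A i j * F.poly j = MvPolynomial.X i ^ (m + F.degree) := by
  set I : Ideal (MvPolynomial (Fin 2) K) := Ideal.span (Set.range F.poly) with hI
  have hrad : ∀ i : Fin 2, MvPolynomial.X i ∈ I.radical := by
    intro i
    rw [← MvPolynomial.vanishingIdeal_zeroLocus_eq_radical (K := AlgebraicClosure K) I,
      MvPolynomial.mem_vanishingIdeal_iff]
    intro x hx
    have hx0 : x = 0 := by
      refine F.eq_zero_of_eval_eq_zero x fun j ↦ ?_
      have := hx (F.poly j) (Ideal.subset_span ⟨j, rfl⟩)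
      rwa [MvPolynomial.aeval_def] at this
    simp [hx0]
  choose n hn using hrad
  set m := n 0 + n 1 with hm
  have hmem : ∀ i : Fin 2, (MvPolynomial.X i : MvPolynomial (Fin 2) K) ^ (m + F.degree) ∈ I := by
    intro i
    have hle : n i ≤ m + F.degree := by
      fin_cases i <;> simp [hm] <;> omega
    exact Ideal.pow_mem_of_pow_mem I (hn i) hle
  have hex : ∀ i : Fin 2, ∃ c : Fin 2 → MvPolynomial (Fin 2) K,
      ∑ j, c j * F.poly j = MvPolynomial.X i ^ (m + F.degree) := by
    intro i
    obtain ⟨c, hc⟩ := (Submodule.mem_span_range_iff_exists_fun _).1 (hmem i)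
    exact ⟨c, by simpa using hc⟩
  choose c hc using hex
  -- only the components of degree `m` of the coefficients contribute in degree `m + deg F`
  refine ⟨m, fun i j ↦ MvPolynomial.homogeneousComponent m (c i j),
    fun i j ↦ MvPolynomial.homogeneousComponent_isHomogeneous _ _, fun i ↦ ?_⟩
  calc ∑ j, MvPolynomial.homogeneousComponent m (c i j) * F.poly j
      = MvPolynomial.homogeneousComponent (m + F.degree) (∑ j, c i j * F.poly j) := by
        rw [map_sum]
        exact Finset.sum_congr rfl fun j _ ↦
          (homogeneousComponent_mul_of_isHomogeneous _ (F.isHomogeneous j) m).symm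
    _ = MvPolynomial.X i ^ (m + F.degree) := by
        rw [hc i, MvPolynomial.homogeneousComponent_of_mem (n := m + F.degree), if_pos rfl]
        exact (MvPolynomial.mem_homogeneousSubmodule _ _).2 (MvPolynomial.isHomogeneous_X_pow i _)

/-! ### Local estimates for forms and lifts -/

section LocalEstimates

variable {K : Type*} [Field K] {L : Type*} [NormedField L] (σ : K →+* L)

lemma norm_monomial_le {p : MvPolynomial (Fin 2) K} {d : ℕ} (hp : p.IsHomogeneous d)
    (z : Fin 2 → L) {s : Fin 2 →₀ ℕ} (hs : s ∈ p.support) :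
    ‖σ (p.coeff s) * ∏ i, z i ^ s i‖ ≤ ‖σ (p.coeff s)‖ * ‖z‖ ^ d := by
  rw [norm_mul, norm_prod]
  refine mul_le_mul_of_nonneg_left ?_ (norm_nonneg _)
  have hd : d = ∑ i, s i := by
    rw [hp.degree_eq_sum_deg_support hs]
    exact Finset.sum_subset (Finset.subset_univ _) fun i _ hi ↦ Finsupp.notMem_support_iff.1 hi
  rw [hd, ← Finset.prod_pow_eq_pow_sum]
  refine Finset.prod_le_prod (fun i _ ↦ norm_nonneg _) fun i _ ↦ ?_
  rw [norm_pow]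
  exact pow_le_pow_left₀ (norm_nonneg _) (norm_le_pi_norm z i) _

lemma norm_eval₂_le {p : MvPolynomial (Fin 2) K} {d : ℕ} (hp : p.IsHomogeneous d)
    (z : Fin 2 → L) :
    ‖p.eval₂ σ z‖ ≤ (∑ s ∈ p.support, ‖σ (p.coeff s)‖) * ‖z‖ ^ d := by
  rw [MvPolynomial.eval₂_eq', Finset.sum_mul]
  exact (norm_sum_le _ _).trans (Finset.sum_le_sum fun s hs ↦ norm_monomial_le σ hp z hs)

lemma norm_eval₂_le_of_isUltrametricDist [IsUltrametricDist L] {p : MvPolynomial (Fin 2) K} {d : ℕ}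
    (hp : p.IsHomogeneous d) (hc : ∀ s ∈ p.support, ‖σ (p.coeff s)‖ ≤ 1) (z : Fin 2 → L) :
    ‖p.eval₂ σ z‖ ≤ ‖z‖ ^ d := by
  rw [MvPolynomial.eval₂_eq']
  refine IsUltrametricDist.norm_sum_le_of_forall_le_of_nonneg (by positivity) fun s hs ↦ ?_
  refine (norm_monomial_le σ hp z hs).trans ?_
  exact mul_le_of_le_one_left (by positivity) (hc s hs)

lemma eval₂_smul {p : MvPolynomial (Fin 2) K} {d : ℕ} (hp : p.IsHomogeneous d)
    (c : L) (z : Fin 2 → L) : p.eval₂ σ (c • z) = c ^ d * p.eval₂ σ z := by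
  rw [MvPolynomial.eval₂_eq', MvPolynomial.eval₂_eq', Finset.mul_sum]
  refine Finset.sum_congr rfl fun s hs ↦ ?_
  have hd : d = ∑ i, s i := by
    rw [hp.degree_eq_sum_deg_support hs]
    exact Finset.sum_subset (Finset.subset_univ _) fun i _ hi ↦ Finsupp.notMem_support_iff.1 hi
  simp only [Pi.smul_apply, smul_eq_mul, mul_pow, Finset.prod_mul_distrib]
  rw [hd, Finset.prod_pow_eq_pow_sum]
  ring

lemma Lift.eval_smul (F : Lift K) (c : L) (z : Fin 2 → L) :
    F.eval σ (c • z) = c ^ F.degree • F.eval σ z := by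
  ext i
  exact eval₂_smul σ (F.isHomogeneous i) c z

lemma Lift.eval_comp (F : Lift K) (x : Fin 2 → K) :
    F.eval σ (fun i ↦ σ (x i)) = fun i ↦ σ (F.eval (RingHom.id K) x i) := by
  ext i
  simp only [Lift.eval, MvPolynomial.eval₂_eq', map_sum, map_mul, map_prod, map_pow,
    RingHom.id_apply]

/-- The identity `X i ^ (m + d) = ∑ j, A i j * F j` evaluated at a point. -/
lemma sum_eval₂_mul_eval {F : Lift K} {m : ℕ} {A : Fin 2 → Fin 2 → MvPolynomial (Fin 2) K}
    (hA : ∀ i, ∑ j, A i j * F.poly j = MvPolynomial.X i ^ (m + F.degree)) (z : Fin 2 → L)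
    (i : Fin 2) : ∑ j, (A i j).eval₂ σ z * F.eval σ z j = z i ^ (m + F.degree) := by
  have := congrArg (MvPolynomial.eval₂ σ z) (hA i)
  simpa [MvPolynomial.eval₂_sum, MvPolynomial.eval₂_mul, MvPolynomial.eval₂_pow] using! this

lemma exists_norm_eq (z : Fin 2 → L) : ∃ i, ‖z i‖ = ‖z‖ := by
  obtain ⟨i, -, hi⟩ := Finset.exists_mem_eq_sup' (s := Finset.univ) Finset.univ_nonempty
    (fun i ↦ ‖z i‖₊)
  refine ⟨i, ?_⟩
  rw [Pi.norm_def, ← coe_nnnorm, ← hi, Finset.sup'_eq_sup]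

/-- A lift changes the logarithmic size of a nonzero point like multiplication by its degree, up
to a bounded error. -/
lemma Lift.exists_abs_log_norm_eval_sub_le (F : Lift K) :
    ∃ C : ℝ, 0 ≤ C ∧ ∀ z : Fin 2 → L, z ≠ 0 → F.eval σ z ≠ 0 ∧
      |Real.log ‖F.eval σ z‖ - F.degree * Real.log ‖z‖| ≤ C := by
  obtain ⟨m, A, hAhom, hA⟩ := F.exists_sum_mul_eq_X_pow
  set c₁ : ℝ := 1 + ∑ i, ∑ s ∈ (F.poly i).support, ‖σ ((F.poly i).coeff s)‖ with hc₁
  set c₂ : ℝ := 1 + ∑ i, ∑ j, ∑ s ∈ (A i j).support, ‖σ ((A i j).coeff s)‖ with hc₂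
  have h₁ : 1 ≤ c₁ := le_add_of_nonneg_right (by positivity)
  have h₂ : 1 ≤ c₂ := le_add_of_nonneg_right (by positivity)
  have hl₁ := Real.log_nonneg h₁
  have hl₂ := Real.log_nonneg h₂
  refine ⟨Real.log c₁ + Real.log c₂, by positivity, fun z hz ↦ ?_⟩
  have hz' : 0 < ‖z‖ := norm_pos_iff.2 hz
  have hup : ‖F.eval σ z‖ ≤ c₁ * ‖z‖ ^ F.degree := by
    refine (pi_norm_le_iff_of_nonneg (by positivity)).2 fun i ↦ ?_
    refine (norm_eval₂_le σ (F.isHomogeneous i) z).trans ?_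
    refine mul_le_mul_of_nonneg_right ?_ (by positivity)
    have := Finset.single_le_sum (s := Finset.univ)
      (f := fun i ↦ ∑ s ∈ (F.poly i).support, ‖σ ((F.poly i).coeff s)‖)
      (fun i _ ↦ by positivity) (Finset.mem_univ i)
    linarith
  -- the lower bound comes from the Nullstellensatz identity for the largest coordinate of `z`
  have hlow : ‖z‖ ^ F.degree ≤ c₂ * ‖F.eval σ z‖ := by
    obtain ⟨i, hi⟩ := exists_norm_eq z
    have key : ‖z‖ ^ (m + F.degree) ≤ ‖z‖ ^ m * (c₂ * ‖F.eval σ z‖) := by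
      rw [← hi, ← norm_pow, ← sum_eval₂_mul_eval σ hA z i, hi]
      refine (norm_sum_le _ _).trans ?_
      calc ∑ j, ‖(A i j).eval₂ σ z * F.eval σ z j‖
          ≤ ∑ j, (∑ s ∈ (A i j).support, ‖σ ((A i j).coeff s)‖) * ‖z‖ ^ m * ‖F.eval σ z‖ := by
            refine Finset.sum_le_sum fun j _ ↦ ?_
            rw [norm_mul]
            exact mul_le_mul (norm_eval₂_le σ (hAhom i j) z) (norm_le_pi_norm _ _)
              (norm_nonneg _) (by positivity)
        _ = ‖z‖ ^ m * ((∑ j, ∑ s ∈ (A i j).support, ‖σ ((A i j).coeff s)‖) * ‖F.eval σ z‖) := by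
            rw [← Finset.sum_mul, ← Finset.sum_mul]; ring
        _ ≤ ‖z‖ ^ m * (c₂ * ‖F.eval σ z‖) := by
            have := Finset.single_le_sum (s := Finset.univ)
              (f := fun i ↦ ∑ j, ∑ s ∈ (A i j).support, ‖σ ((A i j).coeff s)‖)
              (fun i _ ↦ by positivity) (Finset.mem_univ i)
            gcongr
            linarith
    rw [pow_add] at key
    exact le_of_mul_le_mul_left key (by positivity)
  have hF0 : 0 < ‖F.eval σ z‖ := by
    have : 0 < c₂ * ‖F.eval σ z‖ := (pow_pos hz' _).trans_le hlow
    exact pos_of_mul_pos_right this (by linarith)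
  refine ⟨norm_pos_iff.1 hF0, ?_⟩
  have e₁ := Real.log_le_log hF0 hup
  have e₂ := Real.log_le_log (pow_pos hz' _) hlow
  rw [Real.log_mul (by positivity) (by positivity), Real.log_pow] at e₁
  rw [Real.log_mul (by positivity) (by positivity), Real.log_pow] at e₂
  rw [abs_le]
  constructor <;> linarith

/-- The finitely many coefficients that control where a lift has good reduction: at an ultrametric
absolute value where all of them are integral, the lift multiplies logarithmic sizes by its degree
exactly. -/
lemma Lift.exists_finset_norm_eval_eq (F : Lift K) :
    ∃ s : Finset K, ∀ {L : Type*} [NormedField L] [IsUltrametricDist L] (σ : K →+* L),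
      (∀ c ∈ s, ‖σ c‖ ≤ 1) → ∀ z : Fin 2 → L, z ≠ 0 → ‖F.eval σ z‖ = ‖z‖ ^ F.degree := by
  classical
  obtain ⟨m, A, hAhom, hA⟩ := F.exists_sum_mul_eq_X_pow
  refine ⟨(Finset.univ.biUnion fun i ↦ (F.poly i).support.image (F.poly i).coeff) ∪
    (Finset.univ.biUnion fun i ↦ Finset.univ.biUnion fun j ↦
      (A i j).support.image (A i j).coeff), ?_⟩
  intro L _ _ σ hs z hz
  have hF : ∀ i, ∀ s ∈ (F.poly i).support, ‖σ ((F.poly i).coeff s)‖ ≤ 1 := fun i s h ↦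
    hs _ (Finset.mem_union_left _ (Finset.mem_biUnion.2
      ⟨i, Finset.mem_univ _, Finset.mem_image_of_mem _ h⟩))
  have hA1 : ∀ i j, ∀ s ∈ (A i j).support, ‖σ ((A i j).coeff s)‖ ≤ 1 := fun i j s h ↦
    hs _ (Finset.mem_union_right _ (Finset.mem_biUnion.2 ⟨i, Finset.mem_univ _,
      Finset.mem_biUnion.2 ⟨j, Finset.mem_univ _, Finset.mem_image_of_mem _ h⟩⟩))
  refine le_antisymm ((pi_norm_le_iff_of_nonneg (by positivity)).2 fun i ↦
    norm_eval₂_le_of_isUltrametricDist σ (F.isHomogeneous i) (hF i) z) ?_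
  obtain ⟨i, hi⟩ := exists_norm_eq z
  have hz' : 0 < ‖z‖ := norm_pos_iff.2 hz
  have key : ‖z‖ ^ (m + F.degree) ≤ ‖z‖ ^ m * ‖F.eval σ z‖ := by
    rw [← hi, ← norm_pow, ← sum_eval₂_mul_eval σ hA z i, hi]
    refine IsUltrametricDist.norm_sum_le_of_forall_le_of_nonneg (by positivity) fun j _ ↦ ?_
    rw [norm_mul]
    exact mul_le_mul (norm_eval₂_le_of_isUltrametricDist σ (hAhom i j) (hA1 i j) z)
      (norm_le_pi_norm _ _) (norm_nonneg _) (by positivity)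
  rw [pow_add] at key
  exact le_of_mul_le_mul_left key (by positivity)

end LocalEstimates

/-! ### Completions -/

section Completion

variable {K : Type*} [Field K] (v : AbsoluteValue K ℝ)

lemma norm_embed (x : K) : ‖embed v x‖ = v x := by
  change ‖((WithAbs.toAbs v x : WithAbs v) : v.Completion)‖ = v x
  rw [UniformSpace.Completion.norm_coe]
  rfl

lemma denseRange_embed : DenseRange (embed v) := by
  have h := UniformSpace.Completion.denseRange_coe (α := WithAbs v)
  refine h.mono ?_
  rintro _ ⟨x, rfl⟩
  exact ⟨x.ofAbs, rfl⟩

variable {v}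

lemma isUltrametricDist_completion (hv : IsNonarchimedean v) : IsUltrametricDist v.Completion := by
  refine IsUltrametricDist.isUltrametricDist_of_forall_norm_add_le_max_norm fun x y ↦ ?_
  induction x, y using (denseRange_embed v).induction_on₂ with
  | hp =>
    exact isClosed_le (by fun_prop) (by fun_prop)
  | h a b =>
    rw [← map_add, norm_embed, norm_embed, norm_embed]
    exact hv a b

end Completion

/-! ### The Green function of a sequence of lifts -/

section Green

variable {K : Type*} [Field K] (v : AbsoluteValue K ℝ)

/-- Every lift in the sequence changes logarithmic sizes at `v` like multiplication by its degree,
up to the uniform error `C`. -/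
def UniformlyBounded (Γ : ℕ → Lift K) (C : ℝ) : Prop :=
  ∀ n, ∀ z : Fin 2 → v.Completion, z ≠ 0 → (Γ n).eval (embed v) z ≠ 0 ∧
    |Real.log ‖(Γ n).eval (embed v) z‖ - (Γ n).degree * Real.log ‖z‖| ≤ C

variable {v} {Γ : ℕ → Lift K} {C : ℝ}

lemma liftOrbit_ne_zero (hΓ : UniformlyBounded v Γ C) {z : Fin 2 → v.Completion} (hz : z ≠ 0)
    (n : ℕ) : liftOrbit v Γ z n ≠ 0 := by
  induction n with
  | zero => exact hz
  | succ n ih => exact (hΓ n _ ih).1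

lemma two_pow_le_prod_degree (hd : ∀ n, 2 ≤ (Γ n).degree) (n : ℕ) :
    2 ^ n ≤ ∏ i ∈ Finset.range n, (Γ i).degree := by
  calc 2 ^ n = ∏ _i ∈ Finset.range n, 2 := by simp
    _ ≤ _ := Finset.prod_le_prod' fun i _ ↦ hd i

/-- One more map changes the Green sequence by at most the error `C` divided by the degree of the
iterate, which is at least `2 ^ n`. -/
lemma dist_greenSeq_succ_le (hC : 0 ≤ C) (hΓ : UniformlyBounded v Γ C)
    (hd : ∀ n, 2 ≤ (Γ n).degree) {z : Fin 2 → v.Completion} (hz : z ≠ 0) (n : ℕ) :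
    dist (greenSeq v Γ z n) (greenSeq v Γ z (n + 1)) ≤ C * (1 / 2) ^ n := by
  have hD : (2 : ℝ) ^ n ≤ ((∏ i ∈ Finset.range n, (Γ i).degree : ℕ) : ℝ) := by
    exact_mod_cast two_pow_le_prod_degree hd n
  set D : ℝ := ((∏ i ∈ Finset.range n, (Γ i).degree : ℕ) : ℝ) with hDdef
  have hD0 : 0 < D := lt_of_lt_of_le (by positivity) hD
  have hdn : (1 : ℝ) ≤ (Γ n).degree := by exact_mod_cast (by have := hd n; omega)
  have hb := (hΓ n _ (liftOrbit_ne_zero hΓ hz n)).2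
  have hs : greenSeq v Γ z (n + 1) = Real.log ‖(Γ n).eval (embed v) (liftOrbit v Γ z n)‖ /
      (D * (Γ n).degree) := by
    rw [greenSeq, Finset.prod_range_succ, Nat.cast_mul]; rfl
  have hn : greenSeq v Γ z n = ((Γ n).degree * Real.log ‖liftOrbit v Γ z n‖) /
      (D * (Γ n).degree) := by
    rw [greenSeq, ← hDdef]; field_simp
  rw [dist_comm, Real.dist_eq, hs, hn, ← sub_div, abs_div, abs_of_pos (a := D * _) (by positivity),
    one_div, inv_pow, ← div_eq_mul_inv]
  refine div_le_div₀ hC hb (by positivity) ?_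
  nlinarith

lemma tendsto_greenSeq (hC : 0 ≤ C) (hΓ : UniformlyBounded v Γ C)
    (hd : ∀ n, 2 ≤ (Γ n).degree) {z : Fin 2 → v.Completion} (hz : z ≠ 0) :
    Tendsto (greenSeq v Γ z) atTop (nhds (green v Γ z)) :=
  (cauchySeq_of_le_geometric (1 / 2) C (by norm_num)
    (dist_greenSeq_succ_le hC hΓ hd hz)).tendsto_limUnder

/-- The sum of the geometric series bounds the distance of the Green function from the zeroth term
`log ‖z‖` of its sequence. -/
lemma abs_green_sub_log_norm_le (hC : 0 ≤ C) (hΓ : UniformlyBounded v Γ C)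
    (hd : ∀ n, 2 ≤ (Γ n).degree) {z : Fin 2 → v.Completion} (hz : z ≠ 0) :
    |green v Γ z - Real.log ‖z‖| ≤ 2 * C := by
  have h := dist_le_of_le_geometric_of_tendsto₀ (1 / 2) C (by norm_num)
    (dist_greenSeq_succ_le hC hΓ hd hz) (tendsto_greenSeq hC hΓ hd hz)
  have h0 : greenSeq v Γ z 0 = Real.log ‖z‖ := by simp [greenSeq, liftOrbit]
  rw [dist_comm, Real.dist_eq, h0] at h
  exact h.trans_eq (by ring)

lemma liftOrbit_smul (c : v.Completion) (z : Fin 2 → v.Completion) (n : ℕ) :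
    liftOrbit v Γ (c • z) n = c ^ (∏ i ∈ Finset.range n, (Γ i).degree) • liftOrbit v Γ z n := by
  induction n with
  | zero => simp [liftOrbit]
  | succ n ih =>
    rw [liftOrbit, ih, Lift.eval_smul, ← pow_mul, Finset.prod_range_succ, liftOrbit]

/-- The orbit of `c • z` is that of `z` scaled by `c ^ deg`, so the Green function is
logarithmically homogeneous of degree one. -/
lemma green_smul (hC : 0 ≤ C) (hΓ : UniformlyBounded v Γ C)
    (hd : ∀ n, 2 ≤ (Γ n).degree) {z : Fin 2 → v.Completion} (hz : z ≠ 0) {c : v.Completion}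
    (hc : c ≠ 0) : green v Γ (c • z) = Real.log ‖c‖ + green v Γ z := by
  have h1 := tendsto_greenSeq hC hΓ hd (smul_ne_zero hc hz)
  refine tendsto_nhds_unique h1 (((tendsto_greenSeq hC hΓ hd hz).const_add _).congr fun n ↦ ?_)
  have hD : (0 : ℝ) < ((∏ i ∈ Finset.range n, (Γ i).degree : ℕ) : ℝ) := by
    exact_mod_cast lt_of_lt_of_le (by positivity) (two_pow_le_prod_degree hd n)
  have hz' := liftOrbit_ne_zero hΓ hz n
  rw [greenSeq, greenSeq, liftOrbit_smul, norm_smul, norm_pow,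
    Real.log_mul (pow_ne_zero _ (norm_ne_zero_iff.2 hc)) (norm_ne_zero_iff.2 hz'), Real.log_pow]
  field_simp

lemma localHeightAt_smul (hC : 0 ≤ C) (hΓ : UniformlyBounded v Γ C)
    (hd : ∀ n, 2 ≤ (Γ n).degree) {e : ℕ} {E : MvPolynomial (Fin 2) K} (hE : E.IsHomogeneous e)
    {z : Fin 2 → v.Completion} (hz : z ≠ 0) (hEz : E.eval₂ (embed v) z ≠ 0) {c : v.Completion}
    (hc : c ≠ 0) : localHeightAt v Γ e E (c • z) = localHeightAt v Γ e E z := by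
  rw [localHeightAt, localHeightAt, green_smul hC hΓ hd hz hc, eval₂_smul _ hE, norm_mul, norm_pow,
    Real.log_mul (pow_ne_zero _ (norm_ne_zero_iff.2 hc)) (norm_ne_zero_iff.2 hEz), Real.log_pow]
  ring

/-- The local height of a point can be computed at any of its representatives. -/
lemma localHeight_mk (hC : 0 ≤ C) (hΓ : UniformlyBounded v Γ C)
    (hd : ∀ n, 2 ≤ (Γ n).degree) {e : ℕ} {E : MvPolynomial (Fin 2) K} (hE : E.IsHomogeneous e)
    {z : Fin 2 → v.Completion} (hz : z ≠ 0) (hEz : E.eval₂ (embed v) z ≠ 0) :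
    localHeight v Γ e E (Projectivization.mk v.Completion z hz) = localHeightAt v Γ e E z := by
  obtain ⟨a, ha⟩ := Projectivization.exists_smul_eq_mk_rep v.Completion z hz
  rw [localHeight, ← ha]
  exact localHeightAt_smul hC hΓ hd hE hz hEz a.ne_zero

lemma liftOrbit_congr {Γ Γ' : ℕ → Lift K} (z : Fin 2 → v.Completion) {n : ℕ}
    (h : ∀ i < n, Γ i = Γ' i) : liftOrbit v Γ z n = liftOrbit v Γ' z n := by
  induction n with
  | zero => rfl
  | succ n ih => rw [liftOrbit, liftOrbit, ih fun i hi ↦ h i (by omega), h n (by omega)]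

lemma greenSeq_congr {Γ Γ' : ℕ → Lift K} (z : Fin 2 → v.Completion) {n : ℕ}
    (h : ∀ i < n, Γ i = Γ' i) : greenSeq v Γ z n = greenSeq v Γ' z n := by
  rw [greenSeq, greenSeq, liftOrbit_congr z h,
    Finset.prod_congr rfl fun i hi ↦ by rw [h i (Finset.mem_range.1 hi)]]

end Green

/-! ### Integrability over random sequences -/

/-- A real function of a sequence in a finite discrete space that depends only on the first `n`
terms is measurable. -/
lemma measurable_of_eq_of_forall_lt {S : Type*} [Finite S] [MeasurableSpace S]
    [DiscreteMeasurableSpace S] {f : (ℕ → S) → ℝ} (n : ℕ)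
    (hf : ∀ γ γ' : ℕ → S, (∀ i < n, γ i = γ' i) → f γ = f γ') : Measurable f := by
  rcases isEmpty_or_nonempty S with hS | ⟨⟨s₀⟩⟩
  · exact measurable_of_empty f
  let g : (Fin n → S) → ℝ := fun δ ↦ f fun i ↦ if h : i < n then δ ⟨i, h⟩ else s₀
  have hg : Measurable g := Measurable.of_discrete
  have hfg : f = g ∘ fun (γ : ℕ → S) (i : Fin n) ↦ γ i := by
    ext γ
    exact hf _ _ fun i hi ↦ by simp [hi]
  rw [hfg]
  exact hg.comp (by fun_prop)

section Integrability

variable {K : Type*} [Field K] {v : AbsoluteValue K ℝ} {S : Type*} [Finite S] {F : S → Lift K}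

/-- Finitely many lifts admit a common error bound at every absolute value. -/
lemma exists_uniformlyBounded (v : AbsoluteValue K ℝ) (F : S → Lift K) :
    ∃ C : ℝ, 0 ≤ C ∧ ∀ γ : ℕ → S, UniformlyBounded v (fun n ↦ F (γ n)) C := by
  choose C hC0 hC using fun s ↦ (F s).exists_abs_log_norm_eval_sub_le (embed v)
  have := Fintype.ofFinite S
  refine ⟨∑ s, C s, Finset.sum_nonneg fun s _ ↦ hC0 s, fun γ n z hz ↦ ?_⟩
  exact ⟨(hC (γ n) z hz).1, (hC (γ n) z hz).2.trans
    (Finset.single_le_sum (fun s _ ↦ hC0 s) (Finset.mem_univ _))⟩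

/-- The Green function at a point, as a function of the random sequence, is a bounded limit of
functions of finitely many coordinates. -/
lemma integrable_green [MeasurableSpace S] [DiscreteMeasurableSpace S]
    (hd : ∀ s, 2 ≤ (F s).degree) {z : Fin 2 → v.Completion} (hz : z ≠ 0)
    (ν : Measure (ℕ → S)) [IsFiniteMeasure ν] :
    Integrable (fun γ : ℕ → S ↦ green v (fun n ↦ F (γ n)) z) ν := by
  obtain ⟨C, hC, hb⟩ := exists_uniformlyBounded v F
  have hmeas : Measurable fun γ : ℕ → S ↦ green v (fun n ↦ F (γ n)) z := by
    refine measurable_of_tendsto_metrizable (f := fun n γ ↦ greenSeq v (fun n ↦ F (γ n)) z n)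
      (fun n ↦ measurable_of_eq_of_forall_lt n fun γ γ' h ↦
        greenSeq_congr z fun i hi ↦ by rw [h i hi]) ?_
    exact tendsto_pi_nhds.2 fun γ ↦ tendsto_greenSeq hC (hb γ) (fun n ↦ hd (γ n)) hz
  refine Integrable.of_bound hmeas.aestronglyMeasurable (|Real.log ‖z‖| + 2 * C)
    (Eventually.of_forall fun γ ↦ ?_)
  have h := abs_green_sub_log_norm_le hC (hb γ) (fun n ↦ hd (γ n)) hz
  have h2 := abs_add_le (green v (fun n ↦ F (γ n)) z - Real.log ‖z‖) (Real.log ‖z‖)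
  rw [sub_add_cancel] at h2
  rw [Real.norm_eq_abs]
  linarith

lemma integrable_localHeightAt [MeasurableSpace S] [DiscreteMeasurableSpace S]
    (hd : ∀ s, 2 ≤ (F s).degree) {z : Fin 2 → v.Completion} (hz : z ≠ 0)
    (ν : Measure (ℕ → S)) [IsFiniteMeasure ν] (e : ℕ) (E : MvPolynomial (Fin 2) K) :
    Integrable (fun γ : ℕ → S ↦ localHeightAt v (fun n ↦ F (γ n)) e E z) ν :=
  ((integrable_green hd hz ν).const_mul _).sub (integrable_const _)

end Integrability

/-! ### Global heights from the product formula -/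

/-- The facts about the places of a global field that the theory of heights uses: a nonzero
element is a unit at almost all places, almost all places are nonarchimedean, and the product
formula holds. -/
structure HasProductFormula (K : Type*) [Field K] : Prop where
  finite_ne_one : ∀ x : K, x ≠ 0 → {v : places K | v.1 x ≠ 1}.Finite
  finite_archimedean : {v : places K | ¬ IsNonarchimedean v.1}.Finite
  finsum_eq_zero : ∀ x : K, x ≠ 0 → ∑ᶠ v : places K, localDegree v.1 * Real.log (v.1 x) = 0

section Global

variable {K : Type*} [Field K]

lemma embed_comp_ne_zero (v : AbsoluteValue K ℝ) {x : Fin 2 → K} (hx : x ≠ 0) :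
    (fun i ↦ embed v (x i)) ≠ 0 := by
  intro h
  refine hx (funext fun i ↦ (embed v).injective ?_)
  simpa using congrFun h i

lemma norm_embed_comp (v : AbsoluteValue K ℝ) (x : Fin 2 → K) :
    ‖fun i ↦ embed v (x i)‖ = max (v (x 0)) (v (x 1)) := by
  rw [Pi.norm_def]
  simp [Finset.sup, Fin.univ_succ, norm_embed, ← norm_toNNReal]

variable (hK : HasProductFormula K)
include hK

lemma finite_norm_ne_one {x : Fin 2 → K} (hx : x ≠ 0) :
    {v : places K | max (v.1 (x 0)) (v.1 (x 1)) ≠ 1}.Finite := by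
  have h : ∀ i, {v : places K | x i ≠ 0 ∧ v.1 (x i) ≠ 1}.Finite := by
    intro i
    by_cases hi : x i = 0
    · simp [hi]
    · exact (hK.finite_ne_one _ hi).subset fun v hv ↦ hv.2
  refine ((h 0).union (h 1)).subset fun v hv ↦ ?_
  by_contra hcon
  simp only [Set.mem_union, Set.mem_ofPred_eq, not_or, not_and, not_not] at hcon
  refine hv ?_
  by_cases h0 : x 0 = 0
  · have h1 : x 1 ≠ 0 := fun h1 ↦ hx (by ext i; fin_cases i <;> simp [h0, h1])
    simp [h0, hcon.2 h1]
  · by_cases h1 : x 1 = 0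
    · simp [h1, hcon.1 h0]
    · simp [hcon.1 h0, hcon.2 h1]

/-- By the product formula, the Weil height can be computed at any representative. -/
lemma weilHeight_mk {x : Fin 2 → K} (hx : x ≠ 0) :
    weilHeight (Projectivization.mk K x hx) =
      ∑ᶠ v : places K, localDegree v.1 * Real.log (max (v.1 (x 0)) (v.1 (x 1))) := by
  obtain ⟨a, ha⟩ := Projectivization.exists_smul_eq_mk_rep K x hx
  have key : ∀ v : places K, localDegree v.1 * Real.log (max (v.1 ((a • x) 0)) (v.1 ((a • x) 1))) =
      localDegree v.1 * Real.log (v.1 a) +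
        localDegree v.1 * Real.log (max (v.1 (x 0)) (v.1 (x 1))) := by
    intro v
    have hpos : max (v.1 (x 0)) (v.1 (x 1)) ≠ 0 := by
      rw [← norm_embed_comp]
      exact norm_ne_zero_iff.2 (embed_comp_ne_zero v.1 hx)
    have hmul : max (v.1 ((a • x) 0)) (v.1 ((a • x) 1)) =
        v.1 a * max (v.1 (x 0)) (v.1 (x 1)) := by
      rw [mul_max_of_nonneg _ _ (v.1.nonneg _)]
      simp [Units.smul_def]
    rw [hmul, Real.log_mul (v.1.ne_zero a.ne_zero) hpos, mul_add]
  rw [weilHeight, ← ha, finsum_congr key, finsum_add_distrib, hK.finsum_eq_zero _ a.ne_zero,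
    zero_add]
  · exact (hK.finite_ne_one _ a.ne_zero).subset fun v hv h ↦ hv (by simp [h])
  · exact (finite_norm_ne_one hK hx).subset fun v hv h ↦ hv (by simp [h])

/-- For finitely many lifts and a nonzero point of `K²`, outside a finite set of places all the
points of all the orbits have norm `1`. -/
lemma exists_finset_norm_liftOrbit_eq_one {S : Type*} [Finite S] (F : S → Lift K)
    {x : Fin 2 → K} (hx : x ≠ 0) :
    ∃ T : Finset (places K), ∀ v ∉ T, ∀ (γ : ℕ → S) (n : ℕ),
      ‖liftOrbit v.1 (fun n ↦ F (γ n)) (fun i ↦ embed v.1 (x i)) n‖ = 1 := by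
  classical
  -- exclude the places where the point does not have norm `1`, the archimedean places, and those
  -- where a relevant coefficient is not integral
  choose s hs using fun a ↦ (F a).exists_finset_norm_eval_eq
  have hfin : ({v : places K | max (v.1 (x 0)) (v.1 (x 1)) ≠ 1} ∪
      {v : places K | ¬ IsNonarchimedean v.1} ∪
      ⋃ a, ⋃ c ∈ s a, {v : places K | 1 < v.1 c}).Finite := by
    refine ((finite_norm_ne_one hK hx).union hK.finite_archimedean).union
      (Set.finite_iUnion fun a ↦ (s a).finite_toSet.biUnion fun c _ ↦ ?_)
    rcases eq_or_ne c 0 with rfl | hc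
    · simp [not_lt_of_ge zero_le_one]
    · exact (hK.finite_ne_one c hc).subset fun v hv ↦ ne_of_gt hv
  refine ⟨hfin.toFinset, fun v hv γ n ↦ ?_⟩
  simp only [Set.Finite.mem_toFinset, Set.mem_union, Set.mem_iUnion, Set.mem_ofPred_eq, not_or,
    not_not, not_exists, not_lt] at hv
  obtain ⟨⟨h1, hna⟩, hc⟩ := hv
  have := isUltrametricDist_completion hna
  induction n with
  | zero => rw [liftOrbit, norm_embed_comp, h1]
  | succ n ih =>
    rw [liftOrbit, hs (γ n) (embed v.1) (fun c hcs ↦ by rw [norm_embed]; exact hc _ c hcs) _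
      (norm_ne_zero_iff.1 (by rw [ih]; exact one_ne_zero)), ih, one_pow]

omit hK in
/-- The orbit of a point of `ℙ¹(K)` lifts to `K²`. -/
lemma exists_orbit_eq_mk {S : Set (Endomorphism K)} {F : S → Lift K}
    (hF : ∀ φ : S, (F φ).IsLiftOf φ) (γ : ℕ → S) {x : Fin 2 → K} (hx : x ≠ 0) (n : ℕ) :
    ∃ (y : Fin 2 → K) (hy : y ≠ 0),
      orbit (fun n ↦ (γ n : Endomorphism K)) (Projectivization.mk K x hx) n =
        Projectivization.mk K y hy ∧
      ∀ v : AbsoluteValue K ℝ, liftOrbit v (fun n ↦ F (γ n)) (fun i ↦ embed v (x i)) n =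
        fun i ↦ embed v (y i) := by
  induction n with
  | zero => exact ⟨x, hx, rfl, fun v ↦ rfl⟩
  | succ n ih =>
    obtain ⟨y, hy, h1, h2⟩ := ih
    obtain ⟨h, h'⟩ := (hF (γ n)).2 y hy
    refine ⟨_, h, ?_, fun v ↦ ?_⟩
    · rw [orbit, h1, h']
    · rw [liftOrbit, h2 v, Lift.eval_comp]

/-- If all orbit points have norm `1` outside the finite set `T` of places, the sequence defining
the canonical height is a sum over `T` of Green sequences. -/
lemma heightSeq_eq_sum {S : Set (Endomorphism K)} {F : S → Lift K}
    (hF : ∀ φ : S, (F φ).IsLiftOf φ) {x : Fin 2 → K} (hx : x ≠ 0) {T : Finset (places K)}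
    (hT : ∀ v ∉ T, ∀ (γ : ℕ → S) (n : ℕ),
      ‖liftOrbit v.1 (fun n ↦ F (γ n)) (fun i ↦ embed v.1 (x i)) n‖ = 1) (γ : ℕ → S) (n : ℕ) :
    heightSeq (fun n ↦ (γ n : Endomorphism K)) (Projectivization.mk K x hx) n =
      ∑ v ∈ T, localDegree v.1 *
        greenSeq v.1 (fun n ↦ F (γ n)) (fun i ↦ embed v.1 (x i)) n := by
  obtain ⟨y, hy, h1, h2⟩ := exists_orbit_eq_mk hF γ hx n
  have hdeg : ∀ i, (F (γ i)).degree = (γ i : Endomorphism K).degree := fun i ↦ (hF (γ i)).1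
  have hsum : weilHeight (Projectivization.mk K y hy) = ∑ v ∈ T, localDegree v.1 *
      Real.log ‖liftOrbit v.1 (fun n ↦ F (γ n)) (fun i ↦ embed v.1 (x i)) n‖ := by
    rw [weilHeight_mk hK hy, finsum_eq_sum_of_support_subset (s := T)]
    · refine Finset.sum_congr rfl fun v _ ↦ ?_
      rw [h2 v.1, norm_embed_comp]
    · intro v hv
      by_contra hcon
      have h3 := hT v hcon γ n
      rw [h2 v.1, norm_embed_comp] at h3
      exact hv (by simp [h3])
  rw [heightSeq, h1, hsum, Finset.sum_div]
  refine Finset.sum_congr rfl fun v _ ↦ ?_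
  simp only [greenSeq, hdeg]
  ring

end Global

/-- The decomposition of the expected canonical height, for a field with a product formula. -/
theorem expectedHeight_eq_of_hasProductFormula {K : Type*} [Field K] (hK : HasProductFormula K)
    (e : ℕ) (E : MvPolynomial (Fin 2) K) (hE : E.IsHomogeneous e)
    (S : Set (Endomorphism K)) (hS : S.Finite) (hdeg : ∀ φ ∈ S, 2 ≤ φ.degree)
    (F : S → Lift K) (hF : ∀ φ : S, (F φ).IsLiftOf φ)
    [MeasurableSpace S] [DiscreteMeasurableSpace S]
    (ν₁ : Measure S) [IsProbabilityMeasure ν₁] (he : 0 < e) (P : P1 K)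
    (hP : MvPolynomial.eval P.rep E ≠ 0) :
    (∀ γ : ℕ → S, ∃ L : ℝ,
        Tendsto (heightSeq (fun n ↦ (γ n : Endomorphism K)) P) atTop (nhds L)) ∧
      Integrable (fun γ : ℕ → S ↦ canonicalHeight (fun n ↦ (γ n : Endomorphism K)) P) (iid ν₁) ∧
      {v : places K | localDegree v.1 *
        expectedLocalHeight ν₁ F e E v.1 (P1.baseChange (embed v.1) P) ≠ 0}.Finite ∧
      expectedHeight ν₁ P = (1 / (e : ℝ)) * ∑ᶠ v : places K, localDegree v.1 *
        expectedLocalHeight ν₁ F e E v.1 (P1.baseChange (embed v.1) P) := by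
  classical
  have := hS.to_subtype
  have : IsProbabilityMeasure (iid ν₁) := by unfold iid; infer_instance
  have hd : ∀ s : S, 2 ≤ (F s).degree := fun s ↦ by
    rw [(hF s).1]; exact hdeg s s.2
  set x : Fin 2 → K := P.rep with hxdef
  have hx : x ≠ 0 := P.rep_nonzero
  have hPx : P = Projectivization.mk K x hx := P.mk_rep.symm
  obtain ⟨T₀, hT₀⟩ := exists_finset_norm_liftOrbit_eq_one hK F hx
  have hEfin := hK.finite_ne_one _ hP
  set T : Finset (places K) := T₀ ∪ hEfin.toFinset with hTdef
  have hT : ∀ v ∉ T, ∀ (γ : ℕ → S) (n : ℕ),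
      ‖liftOrbit v.1 (fun n ↦ F (γ n)) (fun i ↦ embed v.1 (x i)) n‖ = 1 := fun v hv ↦
    hT₀ v fun h ↦ hv (Finset.mem_union_left _ h)
  have hTE : ∀ v ∉ T, v.1 (MvPolynomial.eval x E) = 1 := fun v hv ↦ by
    by_contra h
    exact hv (Finset.mem_union_right _ (hEfin.mem_toFinset.2 h))
  set g : places K → (ℕ → S) → ℝ :=
    fun v γ ↦ green v.1 (fun n ↦ F (γ n)) (fun i ↦ embed v.1 (x i)) with hg
  have hz : ∀ v : places K, (fun i ↦ embed v.1 (x i)) ≠ 0 := fun v ↦ embed_comp_ne_zero v.1 hx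
  have hgint : ∀ v, Integrable (g v) (iid ν₁) := fun v ↦ integrable_green hd (hz v) _
  have htend : ∀ γ : ℕ → S, Tendsto (heightSeq (fun n ↦ (γ n : Endomorphism K)) P) atTop
      (nhds (∑ v ∈ T, localDegree v.1 * g v γ)) := by
    intro γ
    have hseq : heightSeq (fun n ↦ (γ n : Endomorphism K)) P = fun n ↦ ∑ v ∈ T, localDegree v.1 *
        greenSeq v.1 (fun n ↦ F (γ n)) (fun i ↦ embed v.1 (x i)) n := by
      ext n
      rw [hPx]
      exact heightSeq_eq_sum hK hF hx hT γ n
    rw [hseq]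
    refine tendsto_finsetSum _ fun v _ ↦ Tendsto.const_mul _ ?_
    obtain ⟨C, hC, hb⟩ := exists_uniformlyBounded v.1 F
    exact tendsto_greenSeq hC (hb γ) (fun n ↦ hd _) (hz v)
  have hcan : (fun γ : ℕ → S ↦ canonicalHeight (fun n ↦ (γ n : Endomorphism K)) P) =
      fun γ ↦ ∑ v ∈ T, localDegree v.1 * g v γ := by
    ext γ
    exact (htend γ).limUnder_eq
  have hEv : ∀ v : places K, E.eval₂ (embed v.1) (fun i ↦ embed v.1 (x i)) =
      embed v.1 (MvPolynomial.eval x E) := fun v ↦ by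
    rw [MvPolynomial.eval₂_eq', MvPolynomial.eval_eq', map_sum]
    simp
  have hlocal : ∀ v : places K,
      expectedLocalHeight ν₁ F e E v.1 (P1.baseChange (embed v.1) P) =
        e * (∫ γ, g v γ ∂iid ν₁) - Real.log (v.1 (MvPolynomial.eval x E)) := by
    intro v
    have hbase : P1.baseChange (embed v.1) P = Projectivization.mk v.1.Completion
        (fun i ↦ embed v.1 (x i)) (hz v) := by
      conv_lhs => rw [hPx]
      exact Projectivization.map_mk _ _ _ _
    have hE0 : E.eval₂ (embed v.1) (fun i ↦ embed v.1 (x i)) ≠ 0 := by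
      rw [hEv, map_ne_zero_iff _ (embed v.1).injective]
      exact hP
    obtain ⟨C, hC, hb⟩ := exists_uniformlyBounded v.1 F
    have hfun : (fun γ : ℕ → S ↦ localHeight v.1 (fun n ↦ F (γ n)) e E
        (P1.baseChange (embed v.1) P)) =
        fun γ ↦ e * g v γ - Real.log (v.1 (MvPolynomial.eval x E)) := by
      ext γ
      rw [hbase, localHeight_mk hC (hb γ) (fun n ↦ hd _) hE (hz v) hE0, localHeightAt, hEv,
        norm_embed]
    rw [expectedLocalHeight, hfun, integral_sub ((hgint v).const_mul _) (integrable_const _),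
      integral_const_mul, integral_const]
    simp
  have hgT : ∀ v ∉ T, ∫ γ, g v γ ∂iid ν₁ = 0 := by
    intro v hv
    have : g v = fun _ ↦ 0 := by
      ext γ
      refine Tendsto.limUnder_eq ?_
      refine tendsto_const_nhds.congr fun n ↦ ?_
      rw [greenSeq, hT v hv γ n]
      simp
    rw [this]
    simp
  have hsupp : ∀ v ∉ T, localDegree v.1 *
      expectedLocalHeight ν₁ F e E v.1 (P1.baseChange (embed v.1) P) = 0 := by
    intro v hv
    rw [hlocal, hgT v hv, hTE v hv]
    simp
  refine ⟨fun γ ↦ ⟨_, htend γ⟩, ?_, ?_, ?_⟩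
  · rw [hcan]
    exact integrable_finsetSum _ fun v _ ↦ (hgint v).const_mul _
  · refine T.finite_toSet.subset fun v hv ↦ ?_
    by_contra h
    exact hv (hsupp v h)
  · have hprod := hK.finsum_eq_zero _ hP
    rw [finsum_eq_sum_of_support_subset (s := T)] at hprod
    · rw [finsum_eq_sum_of_support_subset (s := T)]
      · rw [expectedHeight, hcan, integral_finsetSum _ fun v _ ↦ (hgint v).const_mul _]
        simp_rw [hlocal, integral_const_mul, mul_sub]
        rw [Finset.sum_sub_distrib, hprod, sub_zero, Finset.mul_sum]
        refine Finset.sum_congr rfl fun v _ ↦ ?_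
        have : (e : ℝ) ≠ 0 := by positivity
        field_simp
      · intro v hv
        by_contra h
        exact hv (hsupp v h)
    · intro v hv
      by_contra h
      exact hv (by simp [hTE v h])

/-- The local canonical heights are well defined and integrable. -/
theorem integrable_localHeight {K : Type*} [Field K]
    (e : ℕ) (E : MvPolynomial (Fin 2) K) (hE : E.IsHomogeneous e)
    {S : Type*} [Finite S] (F : S → Lift K) (hd : ∀ s, 2 ≤ (F s).degree)
    [MeasurableSpace S] [DiscreteMeasurableSpace S]
    (ν : Measure (ℕ → S)) [IsFiniteMeasure ν] (v : AbsoluteValue K ℝ) (P : P1 v.Completion)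
    (hP : E.eval₂ (embed v) P.rep ≠ 0) :
    (∀ (γ : ℕ → S) (z : Fin 2 → v.Completion) (hz : z ≠ 0),
        P = Projectivization.mk v.Completion z hz →
          (∃ L : ℝ, Tendsto (greenSeq v (fun n ↦ F (γ n)) z) atTop (nhds L)) ∧
          localHeight v (fun n ↦ F (γ n)) e E P = localHeightAt v (fun n ↦ F (γ n)) e E z) ∧
      Integrable (fun γ : ℕ → S ↦ localHeight v (fun n ↦ F (γ n)) e E P) ν := by
  obtain ⟨C, hC, hb⟩ := exists_uniformlyBounded v F
  refine ⟨fun γ z hz hPz ↦ ⟨⟨_, tendsto_greenSeq hC (hb γ) (fun n ↦ hd _) hz⟩, ?_⟩, ?_⟩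
  · have hEz : E.eval₂ (embed v) z ≠ 0 := by
      obtain ⟨a, ha⟩ := Projectivization.exists_smul_eq_mk_rep v.Completion z hz
      rw [hPz, ← ha, Units.smul_def, eval₂_smul _ hE] at hP
      exact right_ne_zero_of_mul hP
    rw [hPz]
    exact localHeight_mk hC (hb γ) (fun n ↦ hd _) hE hz hEz
  · exact integrable_localHeightAt hd P.rep_nonzero ν e E

/-! ### Absolute values attached to primes of a Dedekind domain -/

open IsDedekindDomain

section Dedekind

variable {R K : Type*} [CommRing R] [IsDedekindDomain R] [Field K] [Algebra R K]
  [IsFractionRing R K]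

/-- The absolute value `v` belongs to the prime `P`, with `v = exp (-β)` on uniformizers:
`log v x = - β ord_P x`. -/
structure IsAdic (v : AbsoluteValue K ℝ) (P : HeightOneSpectrum R) (β : ℝ) : Prop where
  pos : 0 < β
  log_eq : ∀ x : K, x ≠ 0 → Real.log (v x) = WithZero.log (P.valuation K x) * β

lemma isAdic_adicAbv (P : HeightOneSpectrum R) {b : NNReal} (hb : 1 < b) :
    IsAdic (P.adicAbv (K := K) hb) P (Real.log b) where
  pos := Real.log_pos (by exact_mod_cast hb)
  log_eq x hx := by
    have hx' : P.valuation K x ≠ 0 := (Valuation.ne_zero_iff _).2 hx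
    change Real.log ((WithZeroMulInt.toNNReal (ne_zero_of_lt hb) (P.valuation K x) : NNReal) : ℝ)
      = _
    rw [WithZeroMulInt.toNNReal_neg_apply _ hx', NNReal.coe_zpow, Real.log_zpow]
    congr 2
    generalize P.valuation K x = y at hx'
    lift y to Multiplicative ℤ using hx'
    rfl

lemma log_valuation_algebraMap (P : HeightOneSpectrum R) {r : R} (hr : r ≠ 0) :
    WithZero.log (P.valuation K (algebraMap R K r)) =
      -(multiplicity P.asIdeal (Ideal.span {r}) : ℤ) := by
  rw [HeightOneSpectrum.valuation_of_algebraMap, P.intValuation_eq_exp_neg_multiplicity hr,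
    WithZero.log_exp]

lemma valuation_algebraMap_lt_one_iff (P : HeightOneSpectrum R) (r : R) :
    P.valuation K (algebraMap R K r) < 1 ↔ r ∈ P.asIdeal :=
  P.valuation_lt_one_iff_mem r

namespace IsAdic

variable {v : AbsoluteValue K ℝ} {P : HeightOneSpectrum R} {β : ℝ} (h : IsAdic v P β)
include h

lemma eq_exp {x : K} (hx : x ≠ 0) : v x = Real.exp (WithZero.log (P.valuation K x) * β) := by
  rw [← h.log_eq x hx, Real.exp_log (v.pos hx)]

lemma le_exp_iff (x : K) (n : ℤ) :
    v x ≤ Real.exp (n * β) ↔ P.valuation K x ≤ WithZero.exp n := by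
  rcases eq_or_ne x 0 with rfl | hx
  · simp [(Real.exp_pos _).le]
  · rw [h.eq_exp hx, Real.exp_le_exp, mul_le_mul_iff_left₀ h.pos, Int.cast_le,
      WithZero.log_le_iff_le_exp ((Valuation.ne_zero_iff _).2 hx)]

lemma le_one_iff (x : K) : v x ≤ 1 ↔ P.valuation K x ≤ 1 := by
  simpa using h.le_exp_iff x 0

lemma algebraMap_le_one (r : R) : v (algebraMap R K r) ≤ 1 :=
  (h.le_one_iff _).2 (P.valuation_le_one r)

lemma algebraMap_le_exp_iff (r : R) (n : ℕ) :
    v (algebraMap R K r) ≤ Real.exp (-(n * β)) ↔ r ∈ P.asIdeal ^ n := by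
  rw [← P.intValuation_le_pow_iff_mem, ← P.valuation_of_algebraMap (K := K), ← h.le_exp_iff]
  push_cast
  rw [neg_mul]

lemma algebraMap_lt_one_iff (r : R) : v (algebraMap R K r) < 1 ↔ r ∈ P.asIdeal := by
  constructor
  · intro hlt
    by_contra hr
    have hr0 : algebraMap R K r ≠ 0 := by
      intro h0
      rw [FaithfulSMul.algebraMap_eq_zero_iff] at h0
      exact hr (h0 ▸ Submodule.zero_mem _)
    have hval : P.valuation K (algebraMap R K r) = 1 :=
      le_antisymm (P.valuation_le_one r)
        (not_lt.1 fun hlt ↦ hr ((valuation_algebraMap_lt_one_iff P r).1 hlt))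
    rw [h.eq_exp hr0, hval] at hlt
    simp at hlt
  · intro hr
    refine ((h.algebraMap_le_exp_iff r 1).2 (by simpa using hr)).trans_lt ?_
    simpa using h.pos

lemma isNonarchimedean : IsNonarchimedean v := by
  intro x y
  rcases eq_or_ne x 0 with rfl | hx
  · simp
  rcases eq_or_ne y 0 with rfl | hy
  · simp
  have key := (P.valuation K).map_add x y
  have hx' := (Valuation.ne_zero_iff (P.valuation K)).2 hx
  have hy' := (Valuation.ne_zero_iff (P.valuation K)).2 hy
  rcases le_max_iff.1 key with hle | hle
  · refine le_max_of_le_left ?_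
    rw [h.eq_exp hx, h.le_exp_iff, WithZero.exp_log hx']
    exact hle
  · refine le_max_of_le_right ?_
    rw [h.eq_exp hy, h.le_exp_iff, WithZero.exp_log hy']
    exact hle

/-- Elements of `R` are dense among the `v`-integral elements of its fraction field. -/
lemma exists_sub_le {x : K} (hx : v x ≤ 1) (n : ℕ) :
    ∃ r : R, v (x - algebraMap R K r) ≤ Real.exp (-(n * β)) := by
  obtain ⟨r, hr⟩ := P.exists_valuation_sub_lt_of_integer ((h.le_one_iff x).1 hx)
    (Units.mk0 (WithZero.exp (-(n : ℤ))) WithZero.exp_ne_zero)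
  refine ⟨r, ?_⟩
  have := (h.le_exp_iff (algebraMap R K r - x) (-(n : ℤ))).2 (by simpa using! hr.le)
  rw [v.map_sub]
  simpa using this

/-- The prime is determined by the absolute value. -/
lemma eq_of_isAdic {P' : HeightOneSpectrum R} {β' : ℝ} (h' : IsAdic v P' β') : P = P' := by
  ext r
  rw [← h.algebraMap_lt_one_iff, h'.algebraMap_lt_one_iff]

/-- The residue field of the valuation ring is the residue field of the prime. -/
lemma nonempty_residueField_equiv (hv : IsNonarchimedean v) :
    Nonempty (R ⧸ P.asIdeal ≃+* IsLocalRing.ResidueField (valuationRing v hv)) := by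
  let f : R →+* valuationRing v hv :=
    { toFun := fun r ↦ ⟨algebraMap R K r, h.algebraMap_le_one r⟩
      map_one' := Subtype.ext (map_one _)
      map_mul' := fun a b ↦ Subtype.ext (map_mul _ a b)
      map_zero' := Subtype.ext (map_zero _)
      map_add' := fun a b ↦ Subtype.ext (map_add _ a b) }
  have hmem : ∀ y : valuationRing v hv, IsLocalRing.residue (valuationRing v hv) y = 0 ↔
      v (y : K) < 1 := by
    intro y
    rw [IsLocalRing.residue_eq_zero_iff, IsLocalRing.mem_maximalIdeal, mem_nonunits_iff,
      lt_iff_not_ge, not_iff_not]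
    constructor
    · intro hu
      obtain ⟨w, hw⟩ := hu.exists_right_inv
      have h1 : v (y : K) * v (w : K) = 1 := by
        rw [← map_mul]
        simpa using congrArg (fun t : valuationRing v hv ↦ v (t : K)) hw
      have h2 : v (w : K) ≤ 1 := w.2
      nlinarith [v.nonneg (y : K), v.nonneg (w : K)]
    · intro hy
      have hy0 : (y : K) ≠ 0 := by
        intro h0
        rw [h0, map_zero] at hy
        linarith
      refine IsUnit.of_mul_eq_one ⟨(y : K)⁻¹, ?_⟩ (Subtype.ext (mul_inv_cancel₀ hy0))
      change v (y : K)⁻¹ ≤ 1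
      rw [map_inv₀]
      exact inv_le_one_of_one_le₀ hy
  -- the map from `R` to the residue field has kernel `P` and is onto since `R` is dense
  let g := (IsLocalRing.residue (valuationRing v hv)).comp f
  have hker : RingHom.ker g = P.asIdeal := by
    ext r
    rw [RingHom.mem_ker, ← h.algebraMap_lt_one_iff]
    exact hmem (f r)
  have hsurj : Function.Surjective g := by
    intro z
    obtain ⟨y, rfl⟩ := IsLocalRing.residue_surjective z
    obtain ⟨r, hr⟩ := h.exists_sub_le (x := (y : K)) y.2 1
    refine ⟨r, ?_⟩
    rw [← sub_eq_zero]
    change IsLocalRing.residue (valuationRing v hv) (f r) -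
      IsLocalRing.residue (valuationRing v hv) y = 0
    rw [← map_sub, hmem]
    change v (algebraMap R K r - y) < 1
    rw [v.map_sub]
    exact hr.trans_lt (by simpa using h.pos)
  exact ⟨(Ideal.quotEquivOfEq hker.symm).trans (RingHom.quotientKerEquivOfSurjective hsurj)⟩

end IsAdic

/-- An absolute value on the fraction field of a Dedekind domain `R` that is nonarchimedean,
at most `1` on `R`, and not identically `1` on `R \ {0}` belongs to a prime of `R`. -/
lemma exists_isAdic {v : AbsoluteValue K ℝ} (hna : IsNonarchimedean v)
    (hle : ∀ r : R, v (algebraMap R K r) ≤ 1)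
    (hlt : ∃ r : R, r ≠ 0 ∧ v (algebraMap R K r) < 1) :
    ∃ (P : HeightOneSpectrum R) (β : ℝ), IsAdic v P β := by
  -- the prime consists of the elements of `R` on which `v` is less than `1`
  let I : Ideal R :=
    { carrier := {r | v (algebraMap R K r) < 1}
      add_mem' := fun {a b} ha hb ↦ by
        simp only [Set.mem_ofPred_eq, map_add] at *
        exact (hna _ _).trans_lt (max_lt ha hb)
      zero_mem' := by simp
      smul_mem' := fun c x hx ↦ by
        simp only [Set.mem_ofPred_eq, smul_eq_mul, map_mul] at *
        exact mul_lt_one_of_nonneg_of_lt_one_right (hle c) (v.nonneg _) hx }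
  have hmem : ∀ r, r ∈ I ↔ v (algebraMap R K r) < 1 := fun r ↦ Iff.rfl
  have hprime : I.IsPrime := by
    refine ⟨fun htop ↦ ?_, fun {x y} hxy ↦ ?_⟩
    · have := (hmem 1).1 (htop ▸ Submodule.mem_top)
      simp at this
    · by_contra! hcon
      rw [hmem, hmem, not_lt, not_lt] at hcon
      rw [hmem, map_mul, map_mul] at hxy
      nlinarith [v.nonneg (algebraMap R K x), v.nonneg (algebraMap R K y)]
  have hbot : I ≠ ⊥ := by
    obtain ⟨r, hr0, hr⟩ := hlt
    intro hI
    exact hr0 (by simpa [hI] using (hmem r).2 hr)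
  let P : HeightOneSpectrum R := ⟨I, hprime, hbot⟩
  have hunit : ∀ r ∉ P.asIdeal, v (algebraMap R K r) = 1 := fun r hr ↦
    le_antisymm (hle r) (not_lt.1 hr)
  obtain ⟨π, hπ⟩ := P.valuation_exists_uniformizer' K
  change P.valuation K (algebraMap R K π) = _ at hπ
  have hπ0 : algebraMap R K π ≠ 0 := by
    intro h0
    rw [h0, map_zero] at hπ
    exact WithZero.exp_ne_zero hπ.symm
  have hπlt : v (algebraMap R K π) < 1 := by
    refine (hmem π).1 ((valuation_algebraMap_lt_one_iff (K := K) P π).1 ?_)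
    rw [hπ, ← WithZero.exp_zero, WithZero.exp_lt_exp]
    norm_num
  have hval1 : ∀ y : K, P.valuation K y = 1 → v y = 1 := by
    intro y hy
    obtain ⟨n, d, hnd⟩ := P.exists_primeCompl_mul_eq_of_integer y hy.le
    have hd := hunit d d.2
    have hn : n ∉ P.asIdeal := by
      rw [← valuation_algebraMap_lt_one_iff (K := K), ← hnd, map_mul, hy, one_mul,
        valuation_algebraMap_lt_one_iff]
      exact d.2
    have := congrArg v hnd
    rwa [map_mul, hd, mul_one, hunit n hn] at this
  refine ⟨P, -Real.log (v (algebraMap R K π)), by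
    simpa using Real.log_neg (v.pos hπ0) hπlt, fun x hx ↦ ?_⟩
  have hx' := (Valuation.ne_zero_iff (P.valuation K)).2 hx
  set k := WithZero.log (P.valuation K x) with hk
  have h1 : v (x * algebraMap R K π ^ k) = 1 := by
    refine hval1 _ ?_
    rw [map_mul, map_zpow₀, hπ, ← WithZero.exp_log hx', ← hk, ← WithZero.exp_zsmul,
      ← WithZero.exp_add]
    simp
  have h2 := congrArg Real.log h1
  rw [map_mul, map_zpow₀, Real.log_mul (v.ne_zero hx) (zpow_ne_zero _ (v.ne_zero hπ0)),
    Real.log_zpow, Real.log_one] at h2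
  linarith

/-! ### The index of a principal ideal -/

/-- The index `I ↦ #(R / I)` as a multiplicative map on ideals, with value `0` where the quotient is
infinite. In contrast to `Ideal.absNorm`, `R` need not be finite free over `ℤ`. -/
noncomputable def cardQuotHom (R : Type*) [CommRing R] [IsDedekindDomain R] [Infinite R] :
    Ideal R →* ℕ where
  toFun := Submodule.cardQuot
  map_one' := by rw [Ideal.one_eq_top, Submodule.cardQuot_top]
  map_mul' I J := UniqueFactorizationMonoid.multiplicative_of_coprime Submodule.cardQuot I J
      (Submodule.cardQuot_bot _ _)
      (fun {I J} hI => by simp [Ideal.isUnit_iff.mp hI, Ideal.mul_top])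
      (fun {I} i hI =>
        have : Ideal.IsPrime I := Ideal.isPrime_of_prime hI
        cardQuot_pow_of_prime hI.ne_zero)
      fun {I J} hIJ => cardQuot_mul_of_coprime <| Ideal.isCoprime_iff_sup_eq.mpr
        (Ideal.isUnit_iff.mp
          (hIJ (Ideal.dvd_iff_le.mpr le_sup_left) (Ideal.dvd_iff_le.mpr le_sup_right)))

lemma finite_setOf_mem_asIdeal {r : R} (hr : r ≠ 0) :
    {P : HeightOneSpectrum R | r ∈ P.asIdeal}.Finite := by
  have := Ideal.finite_factors (I := Ideal.span {r}) (by simpa using hr)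
  simpa [Ideal.dvd_span_singleton] using this

lemma maxPowDividing_eq (P : HeightOneSpectrum R) {r : R} (hr : r ≠ 0) :
    P.maxPowDividing (Ideal.span {r}) = P.asIdeal ^ multiplicity P.asIdeal (Ideal.span {r}) :=
  P.maxPowDividing_eq_pow_multiplicity (by simpa using hr)

omit [IsDedekindDomain R] in
lemma finite_quotient_of_mem (P : HeightOneSpectrum R) {r : R} (hr : r ∈ P.asIdeal)
    [Finite (R ⧸ Ideal.span {r})] : Finite (R ⧸ P.asIdeal) :=
  Finite.of_surjective _ (Ideal.Quotient.factor_surjective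
    ((Ideal.span_singleton_le_iff_mem _).2 hr))

/-- The factorization of the ideal `(r)` into primes, on the level of indices. -/
lemma log_cardQuot_span_eq_finsum [Infinite R] {r : R} (hr : r ≠ 0)
    [Finite (R ⧸ Ideal.span {r})] :
    Real.log (Submodule.cardQuot (Ideal.span {r})) = ∑ᶠ P : HeightOneSpectrum R,
      multiplicity P.asIdeal (Ideal.span {r}) * Real.log (Submodule.cardQuot P.asIdeal) := by
  have hspan : Ideal.span {r} ≠ 0 := by simpa using hr
  have hsupp : ∀ P : HeightOneSpectrum R, r ∉ P.asIdeal →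
      multiplicity P.asIdeal (Ideal.span {r}) = 0 := fun P hP ↦
    multiplicity_eq_zero.2 (by rwa [Ideal.dvd_span_singleton])
  set T := (finite_setOf_mem_asIdeal hr).toFinset
  have hT : ∀ P : HeightOneSpectrum R, P ∉ T → r ∉ P.asIdeal := fun P hP h ↦
    hP ((finite_setOf_mem_asIdeal hr).mem_toFinset.2 h)
  conv_lhs => rw [← Ideal.finprod_heightOneSpectrum_factorization hspan]
  rw [finprod_eq_prod_of_mulSupport_subset (s := T), finsum_eq_sum_of_support_subset (s := T)]
  · change Real.log (cardQuotHom R _ : ℕ) = _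
    rw [map_prod, Nat.cast_prod, Real.log_prod]
    · refine Finset.sum_congr rfl fun P _ ↦ ?_
      rw [maxPowDividing_eq P hr, map_pow, Nat.cast_pow, Real.log_pow]
      rfl
    · intro P hP
      rw [maxPowDividing_eq P hr, map_pow]
      have := finite_quotient_of_mem P ((finite_setOf_mem_asIdeal hr).mem_toFinset.1 hP)
      have hpos : 0 < cardQuotHom R P.asIdeal := Nat.card_pos (α := R ⧸ P.asIdeal)
      exact_mod_cast pow_ne_zero _ hpos.ne'
  · intro P hP
    by_contra hcon
    exact hP (by simp [hsupp P (hT P hcon)])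
  · intro P hP
    by_contra hcon
    exact hP (by simp [maxPowDividing_eq P hr, hsupp P (hT P hcon)])

end Dedekind

/-! ### Integral closures in finite, possibly inseparable, extensions -/

section IntegralClosure

/-- A subring of a finite algebra over a Noetherian ring is finite. -/
lemma _root_.RingHom.Finite.of_comp_of_injective {A B C : Type*} [CommRing A] [CommRing B]
    [CommRing C] [IsNoetherianRing A] {f : A →+* B} {g : B →+* C} (hg : Function.Injective g)
    (h : (g.comp f).Finite) : f.Finite := by
  let := f.toAlgebra
  let := (g.comp f).toAlgebra
  have : Module.Finite A C := h
  exact Module.Finite.of_injective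
    ({ toFun := g
       map_add' := map_add g
       map_smul' := fun a b ↦ by
        simp only [Algebra.smul_def]
        exact map_mul g _ _ } : B →ₗ[A] C) hg

variable (A F K : Type*) [CommRing A] [IsDomain A] [IsIntegrallyClosed A] [IsNoetherianRing A]
  [Algebra.FiniteType ℤ A] [Field F] [Field K] [Algebra A F] [IsFractionRing A F] [Algebra F K]
  [FiniteDimensional F K] [Algebra A K] [IsScalarTower A F K] (p : ℕ) [Fact p.Prime] [CharP F p]

include F p in
/-- In characteristic `p`, the integral closure of a finitely generated integrally closed domain in
a finite extension of its fraction field is finite, even if the extension is inseparable: a power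
of Frobenius embeds it into the integral closure in the separable closure. -/
lemma finite_integralClosure : Module.Finite A (integralClosure A K) := by
  let L := separableClosure F K
  have : ExpChar F p := ExpChar.prime Fact.out
  have : ExpChar L p := expChar_of_injective_algebraMap (algebraMap F L).injective p
  have : IsPurelyInseparable L K := separableClosure.isPurelyInseparable F K
  have : IsScalarTower A L K := ⟨fun a l k ↦ smul_mul_assoc a (l : K) k⟩
  let C := integralClosure A L
  have hC : Module.Finite A C := IsIntegralClosure.finite A F L C
  let n := IsPurelyInseparable.exponent L K
  let φ : K →+* L := IsPurelyInseparable.iterateFrobenius L K p (le_refl n)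
  have hφ : ∀ a : K, algebraMap L K (φ a) = a ^ p ^ n := fun a ↦
    IsPurelyInseparable.algebraMap_iterateFrobenius L p (le_refl n) a
  have hint : ∀ b : integralClosure A K, φ b ∈ C := by
    intro b
    have hb : IsIntegral A (b : K) := b.2
    refine (isIntegral_algHom_iff (IsScalarTower.toAlgHom A L K)
      (algebraMap L K).injective).1 ?_
    change IsIntegral A (algebraMap L K (φ b))
    rw [hφ]
    exact hb.pow _
  -- a power `φ` of Frobenius that maps `K` into `L` also preserves integrality over `A`
  let g : integralClosure A K →+* C :=
    { toFun := fun b ↦ ⟨φ b, hint b⟩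
      map_one' := Subtype.ext (map_one φ)
      map_mul' := fun a b ↦ Subtype.ext (map_mul φ _ _)
      map_zero' := Subtype.ext (map_zero φ)
      map_add' := fun a b ↦ Subtype.ext (map_add φ _ _) }
  have hg : Function.Injective g := fun a b hab ↦
    Subtype.ext (φ.injective (congrArg (fun c : C ↦ (c : L)) hab))
  have : ExpChar C p := RingHom.expChar (algebraMap C L) Subtype.val_injective p
  -- `g` is not `A`-linear: it twists the structure map of `C` by Frobenius, which is a finite
  -- endomorphism because `A` is finitely generated over `ℤ`
  have hcomp : g.comp (algebraMap A (integralClosure A K)) =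
      (iterateFrobenius C p n).comp (algebraMap A C) := by
    refine RingHom.ext fun a ↦ Subtype.ext ((algebraMap L K).injective ?_)
    change algebraMap L K (φ (algebraMap A K a)) = algebraMap L K (algebraMap A L a ^ p ^ n)
    rw [hφ, map_pow, ← IsScalarTower.algebraMap_apply]
  refine RingHom.finite_algebraMap.1 (RingHom.Finite.of_comp_of_injective hg ?_)
  rw [hcomp]
  refine RingHom.IsIntegral.to_finite ?_ ?_
  · intro c
    obtain ⟨P, hP, hPc⟩ := Algebra.IsIntegral.isIntegral (R := A) c
    have hq : 0 < p ^ n := pow_pos (Fact.out (p := p.Prime)).pos n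
    refine ⟨Polynomial.expand A (p ^ n) P, hP.expand hq, ?_⟩
    have h2 := congrArg (iterateFrobenius C p n) hPc
    rw [Polynomial.hom_eval₂, map_zero, iterateFrobenius_def] at h2
    rw [Polynomial.expand_eq_comp_X_pow, Polynomial.eval₂_comp, Polynomial.eval₂_X_pow]
    exact h2
  · have h1 : Algebra.FiniteType ℤ C :=
        Algebra.FiniteType.trans (S := A) inferInstance inferInstance
    refine RingHom.FiniteType.of_comp_finiteType (f := algebraMap ℤ A) ?_
    have : ((iterateFrobenius C p n).comp (algebraMap A C)).comp (algebraMap ℤ A) =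
      algebraMap ℤ C := RingHom.ext_int _ _
    rw [this]
    exact RingHom.finiteType_algebraMap.2 h1

end IntegralClosure

/-! ### The degree of the divisor of zeros in a function field -/

/-- The index of a principal ideal generated by an element of the base ring in a free algebra. -/
lemma cardQuot_span_algebraMap {A B : Type*} [CommRing A] [CommRing B]
    [Algebra A B] [Module.Finite A B] [Module.Free A B] [Nontrivial A] (a : A) :
    Submodule.cardQuot (Ideal.span {algebraMap A B a}) =
      Submodule.cardQuot (Ideal.span {a}) ^ Module.finrank A B := by
  let b := Module.finBasis A B
  let n := Module.finrank A B
  let S : Submodule A B := (Ideal.span {algebraMap A B a}).restrictScalars A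
  let T : Submodule A (Fin n → A) := Submodule.pi Set.univ fun _ ↦ Ideal.span {a}
  have hST : S.map (b.equivFun : B →ₗ[A] (Fin n → A)) = T := by
    ext y
    simp only [Submodule.mem_map, S, T, Submodule.restrictScalars_mem, Submodule.mem_pi,
      Ideal.mem_span_singleton', Set.mem_univ, true_imp_iff]
    constructor
    · rintro ⟨_, ⟨c, rfl⟩, rfl⟩ i
      refine ⟨b.equivFun c i, ?_⟩
      rw [mul_comm c, ← Algebra.smul_def, LinearEquiv.coe_coe, map_smul, Pi.smul_apply,
        smul_eq_mul, mul_comm]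
    · intro hy
      choose c hc using hy
      refine ⟨_, ⟨b.equivFun.symm c, rfl⟩, ?_⟩
      rw [mul_comm, ← Algebra.smul_def, LinearEquiv.coe_coe, map_smul,
        LinearEquiv.apply_symm_apply]
      ext i
      rw [Pi.smul_apply, smul_eq_mul, mul_comm, hc]
  have e₁ : (B ⧸ S) ≃ ((Fin n → A) ⧸ T) := (Submodule.Quotient.equiv S T b.equivFun hST).toEquiv
  have e₂ : ((Fin n → A) ⧸ T) ≃ (Fin n → A ⧸ Ideal.span {a}) :=
    (Submodule.quotientPi fun _ ↦ Ideal.span {a}).toEquiv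
  rw [Submodule.cardQuot_apply, Submodule.cardQuot_apply]
  calc Nat.card (B ⧸ Ideal.span {algebraMap A B a}) = Nat.card (B ⧸ S) := rfl
    _ = _ := by rw [Nat.card_congr (e₁.trans e₂), Nat.card_fun, Nat.card_fin]

section FunctionField

variable {K : Type*} [Field K] {p : ℕ} [Fact p.Prime] [Algebra (ZMod p) K] {x : K}

open scoped IntermediateField IntermediateField.algebraAdjoinAdjoin

/-- The polynomial ring in `x`, identified with a subring of `K`. -/
noncomputable def polynomialEquivAdjoin (hx : Transcendental (ZMod p) x) :
    Polynomial (ZMod p) ≃ₐ[ZMod p] Algebra.adjoin (ZMod p) {x} :=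
  (AlgEquiv.ofInjective (Polynomial.aeval x)
    (transcendental_iff_injective.1 hx)).trans
    (Subalgebra.equivOfEq _ _ (Algebra.adjoin_singleton_eq_range_aeval (ZMod p) x).symm)

lemma polynomialEquivAdjoin_X (hx : Transcendental (ZMod p) x) :
    polynomialEquivAdjoin hx Polynomial.X =
      ⟨x, Algebra.self_mem_adjoin_singleton (ZMod p) x⟩ := by
  apply Subtype.ext
  change Polynomial.aeval x Polynomial.X = x
  simp

lemma isPrincipalIdealRing_adjoin (hx : Transcendental (ZMod p) x) :
    IsPrincipalIdealRing (Algebra.adjoin (ZMod p) {x}) :=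
  IsPrincipalIdealRing.of_surjective (polynomialEquivAdjoin hx).toRingHom
    (polynomialEquivAdjoin hx).surjective

/-- The index of `(x)` in `𝔽_p[x]` is `p`. -/
lemma cardQuot_span_self (hx : Transcendental (ZMod p) x) :
    Submodule.cardQuot (Ideal.span {(⟨x, Algebra.self_mem_adjoin_singleton (ZMod p) x⟩ :
      Algebra.adjoin (ZMod p) {x})}) = p := by
  have e₁ := Ideal.quotientEquiv (Ideal.span {(Polynomial.X : Polynomial (ZMod p))})
    (Ideal.span {(⟨x, Algebra.self_mem_adjoin_singleton (ZMod p) x⟩ :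
      Algebra.adjoin (ZMod p) {x})}) (polynomialEquivAdjoin hx).toRingEquiv (by
        rw [Ideal.map_span, Set.image_singleton]
        exact congrArg (fun t ↦ Ideal.span {t}) (polynomialEquivAdjoin_X hx).symm)
  have e₂ := Polynomial.quotientSpanXSubCAlgEquiv (0 : ZMod p)
  rw [map_zero, sub_zero] at e₂
  rw [Submodule.cardQuot_apply, ← Nat.card_congr e₁.toEquiv, Nat.card_congr e₂.toEquiv,
    Nat.card_zmod]

variable [FiniteDimensional (ZMod p)⟮x⟯ K]

/-- The ring of elements of `K` integral over `𝔽_p[x]`. -/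
abbrev integralRing (p : ℕ) [Fact p.Prime] [Algebra (ZMod p) K] (x : K) :
    Subalgebra (Algebra.adjoin (ZMod p) {x}) K :=
  integralClosure (Algebra.adjoin (ZMod p) {x}) K

lemma finite_integralRing (hx : Transcendental (ZMod p) x) :
    Module.Finite (Algebra.adjoin (ZMod p) {x}) (integralRing p x) := by
  have := isPrincipalIdealRing_adjoin hx
  have : Algebra.FiniteType ℤ (Algebra.adjoin (ZMod p) {x}) :=
    Algebra.FiniteType.trans (S := ZMod p) inferInstance
      ((Subalgebra.fg_iff_finiteType _).1 ⟨{x}, by simp⟩)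
  have : CharP (ZMod p)⟮x⟯ p := charP_of_injective_algebraMap
    (algebraMap (ZMod p) (ZMod p)⟮x⟯).injective p
  exact finite_integralClosure (Algebra.adjoin (ZMod p) {x}) (ZMod p)⟮x⟯ K p

lemma isFractionRing_integralRing (hx : Transcendental (ZMod p) x) :
    IsFractionRing (integralRing p x) K :=
  have := finite_integralRing hx
  IsIntegralClosure.isFractionRing_of_finite_extension (Algebra.adjoin (ZMod p) {x})
    (ZMod p)⟮x⟯ K (integralRing p x)

lemma isDedekindDomain_integralRing (hx : Transcendental (ZMod p) x) :
    IsDedekindDomain (integralRing p x) := by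
  have := isPrincipalIdealRing_adjoin hx
  have := finite_integralRing hx
  have := isFractionRing_integralRing hx
  have : IsIntegrallyClosed (integralRing p x) :=
    (isIntegrallyClosed_iff K).mpr fun {y} hy ↦
      ⟨IsIntegralClosure.mk' (integralRing p x) y
        (isIntegral_trans (R := Algebra.adjoin (ZMod p) {x}) _ hy),
        IsIntegralClosure.algebraMap_mk' _ _ _⟩
  have := IsNoetherianRing.of_finite (Algebra.adjoin (ZMod p) {x}) (integralRing p x)
  have := Ring.DimensionLEOne.of_isIntegral (Algebra.adjoin (ZMod p) {x}) (integralRing p x)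
  exact { }

lemma finrank_integralRing (hx : Transcendental (ZMod p) x) :
    Module.finrank (Algebra.adjoin (ZMod p) {x}) (integralRing p x) =
      Module.finrank (ZMod p)⟮x⟯ K := by
  have := isFractionRing_integralRing hx
  exact (IsFractionRing.finrank_eq (Algebra.adjoin (ZMod p) {x}) (ZMod p)⟮x⟯
    (integralRing p x) K).symm

/-- The index of `(x)` in the integral closure of `𝔽_p[x]` is `p ^ [K : 𝔽_p(x)]`. -/
lemma cardQuot_span_integralRing (hx : Transcendental (ZMod p) x) :
    Submodule.cardQuot (Ideal.span {algebraMap (Algebra.adjoin (ZMod p) {x}) (integralRing p x)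
      ⟨x, Algebra.self_mem_adjoin_singleton (ZMod p) x⟩}) =
      p ^ Module.finrank (ZMod p)⟮x⟯ K := by
  have := isPrincipalIdealRing_adjoin hx
  have := finite_integralRing hx
  have : Module.Free (Algebra.adjoin (ZMod p) {x}) (integralRing p x) :=
    Module.free_of_finite_type_torsion_free'
  rw [cardQuot_span_algebraMap, cardQuot_span_self hx, finrank_integralRing hx]

end FunctionField

/-! ### Places of a field of positive characteristic -/

/-- An absolute value that is bounded by `1` on the image of `ℕ` is nonarchimedean. -/
lemma isNonarchimedean_of_natCast_le_one {K : Type*} [Field K] (v : AbsoluteValue K ℝ)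
    (h : ∀ n : ℕ, v n ≤ 1) : IsNonarchimedean v := by
  have hu : IsUltrametricDist (WithAbs v) :=
    IsUltrametricDist.isUltrametricDist_of_forall_norm_natCast_le_one fun n ↦ by
      have : ((n : WithAbs v).ofAbs) = n := map_natCast (WithAbs.equiv v) n
      simpa [WithAbs.norm_eq_apply_ofAbs, this] using h n
  intro x y
  have := IsUltrametricDist.norm_add_le_max (WithAbs.toAbs v x) (WithAbs.toAbs v y)
  simpa [WithAbs.norm_eq_apply_ofAbs] using this

lemma eq_one_of_pow_eq_one {K : Type*} [Field K] (v : AbsoluteValue K ℝ) {x : K} {n : ℕ}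
    (hn : n ≠ 0) (hx : x ^ n = 1) : v x = 1 :=
  (pow_eq_one_iff_of_nonneg (v.nonneg x) hn).1 (by rw [← map_pow, hx, map_one])

/-- In characteristic `p` the nonzero natural numbers are roots of unity in the field. -/
lemma isNonarchimedean_of_charP {K : Type*} [Field K] (p : ℕ) [Fact p.Prime] [CharP K p]
    (v : AbsoluteValue K ℝ) : IsNonarchimedean v := by
  refine isNonarchimedean_of_natCast_le_one v fun n ↦ ?_
  by_cases h : (n : K) = 0
  · simp [h]
  · refine (eq_one_of_pow_eq_one v (n := p - 1) (Nat.sub_ne_zero_of_lt (Fact.out : p.Prime).one_lt)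
      ?_).le
    have hz : (n : ZMod p) ≠ 0 := fun hz ↦ h <| by
      rw [CharP.cast_eq_zero_iff K p, ← CharP.cast_eq_zero_iff (ZMod p) p]; exact hz
    have := congrArg (ZMod.castHom (dvd_refl p) K) (ZMod.pow_card_sub_one_eq_one hz)
    simpa using this

section

variable {R K : Type*} [CommRing R] [IsDedekindDomain R] [Field K] [Algebra R K]
  [IsFractionRing R K]

/-- The cardinality of the residue field, in terms of the degree over the prime field. -/
lemma IsAdic.pow_residueDegree {v : AbsoluteValue K ℝ} {P : HeightOneSpectrum R} {β : ℝ}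
    (h : IsAdic v P β) (p : ℕ) [Fact p.Prime] [CharP K p] [Finite (R ⧸ P.asIdeal)] :
    p ^ residueDegree v = Submodule.cardQuot P.asIdeal := by
  have hv := h.isNonarchimedean
  obtain ⟨e⟩ := h.nonempty_residueField_equiv hv
  set k := IsLocalRing.ResidueField (valuationRing v hv) with hk
  have : Finite k := Finite.of_equiv _ e.toEquiv
  have : CharP k p := by
    have h1 : CharP (valuationRing v hv) p :=
      ((valuationRing v hv).subtype.charP_iff (valuationRing v hv).subtype_injective p).2 ‹_›
    exact CharP.of_ringHom_of_ne_zero (IsLocalRing.residue (valuationRing v hv)) p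
      (Fact.out : p.Prime).ne_zero
  rw [residueDegree, dif_pos hv, Submodule.cardQuot_apply, Nat.card_congr e.toEquiv]
  rw [Module.natCard_eq_pow_finrank (K := (⊥ : Subfield k)), Subfield.card_bot k p]

/-- In positive characteristic, the places are the absolute values normalized to value group
`exp ℤ`. -/
lemma IsAdic.mem_places_iff {v : AbsoluteValue K ℝ} {P : HeightOneSpectrum R} {β : ℝ}
    (h : IsAdic v P β) (hK : ¬ CharZero K) : v ∈ places K ↔ β = 1 := by
  obtain ⟨π, hπ⟩ := P.valuation_exists_uniformizer K
  have hπ0 : π ≠ 0 := fun h0 ↦ by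
    rw [h0, map_zero] at hπ
    exact WithZero.exp_ne_zero hπ.symm
  have hval : ∀ n : ℤ, v (π ^ n) = Real.exp (-(n * β)) := by
    intro n
    rw [map_zpow₀, h.eq_exp hπ0, hπ, WithZero.log_exp, ← Real.rpow_intCast, ← Real.exp_mul]
    push_cast
    ring_nf
  simp only [places, Set.mem_ofPred_eq, hK, false_and, false_or, not_false_eq_true, true_and]
  constructor
  · intro hv
    obtain ⟨m, hm⟩ : v (π ^ (1 : ℤ)) ∈ Set.range fun n : ℤ ↦ Real.exp n :=
      hv ▸ ⟨_, zpow_ne_zero _ hπ0, rfl⟩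
    obtain ⟨y, hy, hy1⟩ : Real.exp (1 : ℤ) ∈ v '' {x | x ≠ 0} := hv ▸ ⟨1, rfl⟩
    rw [hval, Real.exp_eq_exp] at hm
    rw [h.eq_exp hy, Real.exp_eq_exp] at hy1
    generalize WithZero.log (P.valuation K y) = k at hy1
    have hm' : β = ((-m : ℤ) : ℝ) := by push_cast at hm ⊢; linarith
    have hpos := h.pos
    rw [hm'] at hy1 hpos ⊢
    have hpos' : 0 < -m := by exact_mod_cast hpos
    have hy1' : k * -m = 1 := by exact_mod_cast hy1
    exact_mod_cast Int.eq_one_of_mul_eq_one_left hpos'.le hy1'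
  · rintro rfl
    ext y
    constructor
    · rintro ⟨x, hx, rfl⟩
      exact ⟨_, by rw [h.eq_exp hx, mul_one]⟩
    · rintro ⟨n, rfl⟩
      refine ⟨π ^ (-n), zpow_ne_zero _ hπ0, ?_⟩
      rw [hval]
      simp

lemma exists_isAdic_of_pos (P : HeightOneSpectrum R) {β : ℝ} (hβ : 0 < β) :
    ∃ v : AbsoluteValue K ℝ, IsAdic v P β := by
  have hb : 1 < (Real.exp β).toNNReal := by simpa using hβ
  have h := isAdic_adicAbv (K := K) P hb
  rw [Real.coe_toNNReal _ (Real.exp_pos β).le, Real.log_exp] at h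
  exact ⟨_, h⟩

/-- In positive characteristic, every prime of a Dedekind domain with fraction field `K` gives a
place of `K`. -/
lemma exists_places_isAdic (hK : ¬ CharZero K) (P : HeightOneSpectrum R) :
    ∃ v : places K, IsAdic v.1 P 1 := by
  obtain ⟨v, hv⟩ := exists_isAdic_of_pos (K := K) P one_pos
  exact ⟨⟨v, (hv.mem_places_iff hK).2 rfl⟩, hv⟩

/-- An absolute value is determined by its prime and its normalization. -/
lemma IsAdic.ext {v w : AbsoluteValue K ℝ} {P : HeightOneSpectrum R} {β : ℝ}
    (hv : IsAdic v P β) (hw : IsAdic w P β) : v = w := by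
  ext x
  rcases eq_or_ne x 0 with rfl | hx
  · simp
  · rw [hv.eq_exp hx, hw.eq_exp hx]

/-- The zeros of a nonzero element `r`, counted with multiplicity and residue degree, have total
degree `log_p #(R / r)`, provided that each of them is a place integral on `R`, hence belongs to a
prime of `R` that contains `r`. -/
lemma finsum_residueDegree_mul_log [Infinite R] (p : ℕ) [Fact p.Prime] [CharP K p] {r : R}
    (hr : r ≠ 0) [Finite (R ⧸ Ideal.span {r})]
    (hle : ∀ v ∈ places K, v (algebraMap R K r) < 1 → ∀ s : R, v (algebraMap R K s) ≤ 1) :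
    {v : places K | v.1 (algebraMap R K r) < 1}.Finite ∧
    ∑ᶠ v ∈ {v : places K | v.1 (algebraMap R K r) < 1},
      residueDegree v.1 * Real.log (v.1 (algebraMap R K r)) * Real.log p =
        - Real.log (Submodule.cardQuot (Ideal.span {r})) := by
  have hK : ¬ CharZero K := fun _ ↦ (Fact.out : p.Prime).ne_zero (CharP.eq K ‹CharP K p›
    (CharP.ofCharZero K))
  choose Φ hΦ using exists_places_isAdic (R := R) hK
  have hbij : Set.BijOn Φ {P | r ∈ P.asIdeal} {v : places K | v.1 (algebraMap R K r) < 1} := by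
    refine ⟨fun P hP ↦ ((hΦ P).algebraMap_lt_one_iff r).2 hP, fun P _ Q _ hPQ ↦
      (hΦ P).eq_of_isAdic (hPQ ▸ hΦ Q), fun v hv ↦ ?_⟩
    obtain ⟨P, β, h⟩ := exists_isAdic (isNonarchimedean_of_charP p v.1) (hle v.1 v.2 hv) ⟨r, hr, hv⟩
    obtain rfl := (h.mem_places_iff hK).1 v.2
    exact ⟨P, (h.algebraMap_lt_one_iff r).1 hv, Subtype.ext ((hΦ P).ext h)⟩
  refine ⟨hbij.image_eq ▸ (finite_setOf_mem_asIdeal hr).image Φ, ?_⟩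
  rw [log_cardQuot_span_eq_finsum hr, ← finsum_neg_distrib]
  rw [← finsum_mem_eq_of_bijOn Φ hbij (f := fun P ↦ -(multiplicity P.asIdeal (Ideal.span {r}) *
    Real.log (Submodule.cardQuot P.asIdeal)))]
  · refine finsum_congr fun P ↦ ?_
    by_cases hP : r ∈ P.asIdeal
    · simp [hP]
    · have : multiplicity P.asIdeal (Ideal.span {r}) = 0 :=
        multiplicity_eq_zero.2 (by rwa [Ideal.dvd_span_singleton])
      simp [hP, this]
  · intro P hP
    have := finite_quotient_of_mem P hP
    have hr' : algebraMap R K r ≠ 0 := by simpa using hr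
    rw [(hΦ P).log_eq _ hr', log_valuation_algebraMap P hr, ← (hΦ P).pow_residueDegree p]
    push_cast
    rw [Real.log_pow]
    ring

end

/-! ### The product formula for function fields -/
open scoped IntermediateField IntermediateField.algebraAdjoinAdjoin

/-- A nonarchimedean absolute value bounded by `1` on a ring is so on its integral closure. -/
lemma le_one_of_isIntegral {A K : Type*} [CommRing A] [Field K] [Algebra A K]
    {v : AbsoluteValue K ℝ} (hv : IsNonarchimedean v) (hA : ∀ a : A, v (algebraMap A K a) ≤ 1)
    {y : K} (hy : IsIntegral A y) : v y ≤ 1 := by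
  let f : A →+* valuationRing v hv := (algebraMap A K).codRestrict (valuationRing v hv) hA
  have h : IsIntegral (valuationRing v hv) y :=
    hy.map_of_comp_eq f (RingHom.id K) (RingHom.ext fun a ↦ rfl)
  obtain ⟨z, rfl⟩ := IsIntegrallyClosed.isIntegral_iff.1 h
  exact z.2

/-- In a finite extension of `k(t)`, any transcendental element generates a subfield of finite
index. -/
lemma finiteDimensional_adjoin_simple {k K : Type*} [Field k] [Field K] [Algebra k K]
    [Algebra (RatFunc k) K] [IsScalarTower k (RatFunc k) K] [FiniteDimensional (RatFunc k) K]
    {x : K} (hx : Transcendental k x) : FiniteDimensional k⟮x⟯ K := by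
  have hx' : AlgebraicIndependent k (fun _ : Unit ↦ x) :=
    (algebraicIndependent_singleton_iff ()).2 hx
  let : Algebra (Polynomial k) K :=
    ((algebraMap (RatFunc k) K).comp (algebraMap (Polynomial k) (RatFunc k))).toAlgebra
  have : IsScalarTower (Polynomial k) (RatFunc k) K := .of_algebraMap_eq fun _ ↦ rfl
  have : IsScalarTower k (Polynomial k) K := .of_algebraMap_eq fun a ↦ by
    rw [IsScalarTower.algebraMap_apply k (RatFunc k) K,
      IsScalarTower.algebraMap_apply k (Polynomial k) (RatFunc k)]
    rfl
  have : Algebra.IsAlgebraic (Polynomial k) K :=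
    (IsFractionRing.comap_isAlgebraic_iff (K := RatFunc k)).2 inferInstance
  have : FaithfulSMul (Polynomial k) K := (faithfulSMul_iff_algebraMap_injective _ _).2
    ((algebraMap (RatFunc k) K).injective.comp (IsFractionRing.injective _ _))
  have htr : Cardinal.lift (Algebra.trdeg k K) ≤ Cardinal.lift (Cardinal.mk Unit) := by
    have := lift_trdeg_add_eq k (Polynomial k) K
    rw [Polynomial.trdeg_of_isDomain, trdeg_eq_zero] at this
    simp at this
    simp [← this]
  -- `K` has transcendence degree one over `k`, so `x` is a transcendence basis; `K` is a finitely
  -- generated and algebraic extension of `k⟮x⟯`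
  have halg := (hx'.isTranscendenceBasis_of_lift_trdeg_le_of_finite htr).isAlgebraic_field
  rw [Set.range_const] at halg
  have : Algebra.EssFiniteType k (RatFunc k) := by
    have : Algebra.EssFiniteType (Polynomial k) (RatFunc k) :=
      .of_isLocalization _ (nonZeroDivisors (Polynomial k))
    exact .comp k (Polynomial k) (RatFunc k)
  have : Algebra.EssFiniteType k K := .comp k (RatFunc k) K
  have : Algebra.EssFiniteType k⟮x⟯ K := .of_comp k k⟮x⟯ K
  exact Algebra.finite_of_essFiniteType_of_isAlgebraic

section

variable {K : Type*} [Field K] {p : ℕ} [Fact p.Prime] [Algebra (ZMod p) K]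

/-- The divisor of zeros of `x` has degree `[K : 𝔽_p(x)]`. -/
lemma finsum_residueDegree_mul_log_eq {x : K} (hx : Transcendental (ZMod p) x)
    [FiniteDimensional (ZMod p)⟮x⟯ K] :
    {v : places K | v.1 x < 1}.Finite ∧
    ∑ᶠ v ∈ {v : places K | v.1 x < 1}, residueDegree v.1 * Real.log (v.1 x) =
      -(Module.finrank (ZMod p)⟮x⟯ K : ℝ) := by
  have := isDedekindDomain_integralRing hx
  have := isFractionRing_integralRing hx
  have : CharP K p := charP_of_injective_algebraMap (algebraMap (ZMod p) K).injective p
  have hp := (Fact.out : p.Prime)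
  set A := Algebra.adjoin (ZMod p) {x}
  set y : integralRing p x := algebraMap A (integralRing p x)
    ⟨x, Algebra.self_mem_adjoin_singleton (ZMod p) x⟩ with hy
  have hyx : algebraMap (integralRing p x) K y = x := rfl
  have hy0 : y ≠ 0 := fun h ↦ by
    have hx0 : x = 0 := hyx.symm.trans (by rw [h, map_zero])
    exact hx (hx0 ▸ isAlgebraic_zero)
  have hcard : Submodule.cardQuot (Ideal.span {y}) = _ := cardQuot_span_integralRing hx
  have : Finite (integralRing p x ⧸ Ideal.span {y}) := by
    rw [Submodule.cardQuot_apply] at hcard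
    exact Nat.finite_of_card_ne_zero (hcard ▸ pow_ne_zero _ hp.ne_zero)
  have : Infinite A := Infinite.of_injective _ (polynomialEquivAdjoin hx).injective
  have : Infinite (integralRing p x) :=
    Infinite.of_injective (algebraMap A (integralRing p x))
      fun a b h ↦ Subtype.ext (congrArg (fun t : integralRing p x ↦ (t : K)) h)
  have key := finsum_residueDegree_mul_log (K := K) p hy0 fun v hv hlt s ↦ by
    have hna := isNonarchimedean_of_charP p v
    refine le_one_of_isIntegral hna (fun a ↦ ?_) s.2
    let B : Subalgebra (ZMod p) K :=
      { (valuationRing v hna).toSubring with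
        algebraMap_mem' := fun c ↦ by
          obtain ⟨n, rfl⟩ := ZMod.natCast_zmod_surjective c
          rw [map_natCast]
          exact natCast_mem (valuationRing v hna) n }
    have hxB : {x} ⊆ (B : Set K) := Set.singleton_subset_iff.2 hlt.le
    exact Algebra.adjoin_le hxB a.2
  rw [hyx, hcard] at key
  refine ⟨key.1, ?_⟩
  have h := key.2
  rw [← finsum_mem_mul] at h
  have hlog : Real.log p ≠ 0 := (Real.log_pos (by exact_mod_cast hp.one_lt)).ne'
  refine mul_right_cancel₀ hlog (h.trans ?_)
  push_cast
  rw [Real.log_pow]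
  ring

/-- A nonzero algebraic element over a finite field is a root of unity. -/
lemma eq_one_of_isAlgebraic (v : AbsoluteValue K ℝ) {x : K} (hx0 : x ≠ 0)
    (hx : IsAlgebraic (ZMod p) x) : v x = 1 := by
  have : FiniteDimensional (ZMod p) (ZMod p)⟮x⟯ :=
    IntermediateField.adjoin.finiteDimensional hx.isIntegral
  have : Finite (ZMod p)⟮x⟯ := Module.finite_of_finite (ZMod p)
  let u : ((ZMod p)⟮x⟯)ˣ := Units.mk0 (IntermediateField.AdjoinSimple.gen (ZMod p) x) fun h ↦
    hx0 (congrArg Subtype.val h)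
  obtain ⟨n, hn, hn1⟩ := (isOfFinOrder_of_finite u).exists_pow_eq_one
  refine eq_one_of_pow_eq_one v hn.ne' ?_
  exact congrArg (fun t : ((ZMod p)⟮x⟯)ˣ ↦ ((t : (ZMod p)⟮x⟯) : K)) hn1

/-- An element that is algebraic over `𝔽_p` is a unit at every place; any other `x` has
`[K : 𝔽_p(x)]` zeros and, since `𝔽_p(x⁻¹) = 𝔽_p(x)`, as many poles. -/
theorem hasProductFormula_of_finiteDimensional_adjoin
    (h : ∀ x : K, Transcendental (ZMod p) x → FiniteDimensional (ZMod p)⟮x⟯ K) :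
    HasProductFormula K := by
  have : CharP K p := charP_of_injective_algebraMap (algebraMap (ZMod p) K).injective p
  have hK : ¬ CharZero K := fun _ ↦ (Fact.out : p.Prime).ne_zero (CharP.eq K ‹CharP K p›
    (CharP.ofCharZero K))
  have hset : ∀ x : K, {v : places K | v.1 x ≠ 1} =
      {v : places K | v.1 x < 1} ∪ {v : places K | v.1 x⁻¹ < 1} := by
    intro x
    ext v
    simp only [Set.mem_ofPred_eq, Set.mem_union, map_inv₀, ne_iff_lt_or_gt]
    rcases eq_or_ne x 0 with rfl | hx
    · simp
    · rw [inv_lt_one₀ (v.1.pos hx)]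
  have hinv : ∀ x : K, Transcendental (ZMod p) x → Transcendental (ZMod p) x⁻¹ :=
    fun x hx hx' ↦ hx (by simpa using hx'.inv)
  refine ⟨fun x hx0 ↦ ?_, ?_, fun x hx0 ↦ ?_⟩
  · by_cases hx : IsAlgebraic (ZMod p) x
    · simp [eq_one_of_isAlgebraic _ hx0 hx]
    · have := h x hx
      have := h x⁻¹ (hinv x hx)
      rw [hset]
      exact (finsum_residueDegree_mul_log_eq hx).1.union
        (finsum_residueDegree_mul_log_eq (hinv x hx)).1
  · simp [isNonarchimedean_of_charP p]
  · by_cases hx : IsAlgebraic (ZMod p) x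
    · simp [eq_one_of_isAlgebraic _ hx0 hx]
    have := h x hx
    have := h x⁻¹ (hinv x hx)
    obtain ⟨h1, h2⟩ := finsum_residueDegree_mul_log_eq hx
    obtain ⟨h3, h4⟩ := finsum_residueDegree_mul_log_eq (hinv x hx)
    have hfield : (ZMod p)⟮x⁻¹⟯ = (ZMod p)⟮x⟯ := by
      apply le_antisymm <;> rw [IntermediateField.adjoin_simple_le_iff]
      · exact inv_mem (IntermediateField.mem_adjoin_simple_self _ x)
      · simpa using inv_mem (IntermediateField.mem_adjoin_simple_self (ZMod p) x⁻¹)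
    rw [hfield] at h4
    have hdisj : Disjoint {v : places K | v.1 x < 1} {v : places K | v.1 x⁻¹ < 1} := by
      refine Set.disjoint_left.2 fun v hv hv' ↦ ?_
      simp only [Set.mem_ofPred_eq, map_inv₀] at hv hv'
      rw [inv_lt_one₀ (v.1.pos hx0)] at hv'
      exact lt_asymm hv hv'
    have hsum : ∑ᶠ v ∈ {v : places K | v.1 x ≠ 1}, (residueDegree v.1 * Real.log (v.1 x)) = 0 := by
      rw [hset, finsum_mem_union hdisj h1 h3, h2, ← h4,
        ← finsum_mem_add_distrib h3]
      simp
    rw [← hsum]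
    refine finsum_congr fun v ↦ ?_
    rw [localDegree, if_neg hK]
    by_cases hv : v.1 x = 1
    · simp [hv]
    · simp [hv]

end

theorem hasProductFormula_of_ratFunc {K : Type*} [Field K] (p : ℕ) [Fact p.Prime]
    [Algebra (RatFunc (ZMod p)) K] [FiniteDimensional (RatFunc (ZMod p)) K] :
    HasProductFormula K := by
  let : Algebra (ZMod p) K :=
    ((algebraMap (RatFunc (ZMod p)) K).comp (algebraMap (ZMod p) (RatFunc (ZMod p)))).toAlgebra
  have : IsScalarTower (ZMod p) (RatFunc (ZMod p)) K := .of_algebraMap_eq fun _ ↦ rfl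
  exact hasProductFormula_of_finiteDimensional_adjoin fun x hx ↦
    finiteDimensional_adjoin_simple (k := ZMod p) hx

/-! ### Archimedean places of number fields -/

open NumberField

section Archimedean

variable {K : Type*} [Field K] [NumberField K]

/-- An absolute value on a number field that extends the real absolute value is bounded by a
multiple of the maximum of the infinite places: expand `x` in a basis dual, for the trace form, to
a given basis. -/
lemma exists_le_mul_of_forall_infinitePlace_le {v : AbsoluteValue K ℝ}
    (hv : ∀ q : ℚ, v (q : K) = |(q : ℝ)|) :
    ∃ C : ℝ, ∀ (x : K) (M : ℝ), (∀ w : InfinitePlace K, w x ≤ M) → v x ≤ C * M := by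
  let b := Module.finBasis ℚ K
  have hB := traceForm_nondegenerate ℚ K
  let b' := (Algebra.traceForm ℚ K).dualBasis hB b
  refine ⟨∑ i, (∑ σ : K →ₐ[ℚ] ℂ, ‖σ (b i)‖) * v (b' i), fun x M hM ↦ ?_⟩
  have htr : ∀ i, |((Algebra.trace ℚ K (x * b i) : ℚ) : ℝ)| ≤
      (∑ σ : K →ₐ[ℚ] ℂ, ‖σ (b i)‖) * M := by
    intro i
    have h := trace_eq_sum_embeddings (K := ℚ) (E := ℂ) (x := x * b i)
    have h' : |((Algebra.trace ℚ K (x * b i) : ℚ) : ℝ)| =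
        ‖algebraMap ℚ ℂ (Algebra.trace ℚ K (x * b i))‖ := by
      rw [eq_ratCast, ← Complex.ofReal_ratCast, Complex.norm_real, Real.norm_eq_abs]
    rw [h', h, Finset.sum_mul]
    refine (norm_sum_le _ _).trans (Finset.sum_le_sum fun σ _ ↦ ?_)
    rw [map_mul, norm_mul, mul_comm]
    exact mul_le_mul_of_nonneg_left (hM (InfinitePlace.mk σ.toRingHom)) (norm_nonneg _)
  calc v x = v (∑ i, b'.repr x i • b' i) := by rw [b'.sum_repr]
    _ ≤ ∑ i, v (b'.repr x i • b' i) := v.sum_le _ _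
    _ ≤ ∑ i, ((∑ σ : K →ₐ[ℚ] ℂ, ‖σ (b i)‖) * M) * v (b' i) := by
      refine Finset.sum_le_sum fun i _ ↦ ?_
      rw [Algebra.smul_def, map_mul, eq_ratCast, hv, LinearMap.BilinForm.dualBasis_repr_apply]
      exact mul_le_mul_of_nonneg_right (htr i) (v.nonneg _)
    _ = _ := by
      rw [Finset.sum_mul]
      exact Finset.sum_congr rfl fun i _ ↦ by ring

/-- The constant in `exists_le_mul_of_forall_infinitePlace_le` can be taken to be `1`: apply the
bound to the powers of `x`. -/
lemma le_of_forall_infinitePlace_le {v : AbsoluteValue K ℝ}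
    (hv : ∀ q : ℚ, v (q : K) = |(q : ℝ)|) {x : K} {M : ℝ}
    (hM : ∀ w : InfinitePlace K, w x ≤ M) : v x ≤ M := by
  obtain ⟨C, hC⟩ := exists_le_mul_of_forall_infinitePlace_le hv
  have hM0 : 0 ≤ M := (apply_nonneg (Classical.arbitrary (InfinitePlace K)) x).trans (hM _)
  have key : ∀ n : ℕ, v x ^ n ≤ C * M ^ n := fun n ↦ by
    rw [← map_pow]
    refine hC _ _ fun w ↦ ?_
    rw [map_pow]
    exact pow_le_pow_left₀ (apply_nonneg w x) (hM w) n
  by_contra! hlt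
  rcases hM0.eq_or_lt with rfl | hM0
  · have := key 1
    simp only [pow_one, mul_zero] at this
    exact this.not_gt hlt
  · have h1 : 1 < v x / M := (one_lt_div hM0).2 hlt
    obtain ⟨n, hn⟩ := pow_unbounded_of_one_lt C h1
    refine hn.not_ge ?_
    rw [div_pow, div_le_iff₀ (pow_pos hM0 n)]
    exact key n

/-- The absolute values extending the real one come from the infinite places: otherwise weak
approximation gives an element that is large at `v` and small at all infinite places. -/
lemma exists_infinitePlace_eq {v : AbsoluteValue K ℝ} (hv : ∀ q : ℚ, v (q : K) = |(q : ℝ)|) :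
    ∃ w : InfinitePlace K, w.1 = v := by
  have h2 : v 2 = 2 := by
    have := hv 2
    simpa using this
  have hex : ∃ w : InfinitePlace K, w.1.IsEquiv v := by
    by_contra! hne
    let u : Option (InfinitePlace K) → AbsoluteValue K ℝ := fun o ↦ o.elim v fun w ↦ w.1
    have hnt : ∀ i, (u i).IsNontrivial := by
      rintro (_ | w)
      · exact ⟨2, two_ne_zero, by simp [u, h2]⟩
      · exact w.isNontrivial
    have hpair : Pairwise fun i j ↦ ¬ (u i).IsEquiv (u j) := by
      rintro (_ | w) (_ | w') hij
      · exact absurd rfl hij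
      · exact fun h ↦ hne w' h.symm
      · exact hne w
      · exact fun h ↦ hij (congrArg some (InfinitePlace.eq_iff_isEquiv.2 h))
    obtain ⟨a, ha, ha'⟩ := AbsoluteValue.exists_one_lt_lt_one_pi_of_not_isEquiv hnt hpair none
    exact ha.not_ge (le_of_forall_infinitePlace_le hv fun w ↦ (ha' (some w) (by simp)).le)
  obtain ⟨w, hw⟩ := hex
  refine ⟨w, ?_⟩
  obtain ⟨c, -, hc⟩ := AbsoluteValue.isEquiv_iff_exists_rpow_eq.1 hw
  have hc1 : c = 1 := by
    have h := congrFun hc 2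
    have hw2 : w.1 2 = 2 := by
      have := w.norm_embedding_eq 2
      rw [map_ofNat] at this
      exact this.symm.trans (by simp)
    rw [hw2, h2] at h
    exact (Real.rpow_right_inj two_pos (by norm_num)).1 (h.trans (Real.rpow_one 2).symm)
  subst hc1
  ext x
  simpa using congrFun hc x

/-- If a field `L` is isometric to a normed `ℝ`-algebra `E`, then its degree over the closure of
the prime field is the dimension of `E`. -/
lemma finrank_topologicalClosure_bot_eq {L E : Type*} [NormedField L] [NormedField E]
    [NormedAlgebra ℝ E] (j : L ≃+* E) (hj : Isometry j) :
    Module.finrank (⊥ : Subfield L).topologicalClosure L = Module.finrank ℝ E := by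
  have : CharZero E := charZero_of_injective_algebraMap (algebraMap ℝ E).injective
  let jh : L ≃ₜ E := (IsometryEquiv.mk j.toEquiv hj).toHomeomorph
  have himg : (⊥ : Subfield L).topologicalClosure.map (j : L →+* E) =
      (algebraMap ℝ E).fieldRange := by
    apply SetLike.coe_injective
    have hbot : ((⊥ : Subfield E) : Set E) = Set.range fun q : ℚ ↦ (q : E) := by
      refine Set.Subset.antisymm ?_ (Set.range_subset_iff.2 fun q ↦ SubfieldClass.ratCast_mem _ q)
      exact (bot_le : (⊥ : Subfield E) ≤ (Rat.castHom E).fieldRange)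
    calc ((⊥ : Subfield L).topologicalClosure.map (j : L →+* E) : Set E)
        = jh '' closure ((⊥ : Subfield L) : Set L) := rfl
      _ = closure (jh '' ((⊥ : Subfield L) : Set L)) := jh.image_closure _
      _ = closure ((⊥ : Subfield E) : Set E) := by
        rw [← Subfield.map_bot (j : L →+* E), Subfield.coe_map]; rfl
      _ = closure (algebraMap ℝ E '' Set.range ((↑) : ℚ → ℝ)) := by
        rw [hbot, ← Set.range_comp]
        congr 2
        ext q
        simp
      _ = algebraMap ℝ E '' closure (Set.range ((↑) : ℚ → ℝ)) :=
        (algebraMap_isometry ℝ E).isClosedEmbedding.closure_image_eq _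
      _ = _ := by
        rw [Rat.denseRange_cast.closure_range, Set.image_univ]
        rfl
  let e₁ : (⊥ : Subfield L).topologicalClosure ≃+*
      (⊥ : Subfield L).topologicalClosure.map (j : L →+* E) :=
    j.subringMap (s := (⊥ : Subfield L).topologicalClosure.toSubring)
  let e₂ : (⊥ : Subfield L).topologicalClosure.map (j : L →+* E) ≃+* (algebraMap ℝ E).fieldRange :=
    RingEquiv.subringCongr (congrArg Subfield.toSubring himg)
  let e₃ : ℝ ≃+* (algebraMap ℝ E).fieldRange :=
    RingEquiv.ofBijective _ (algebraMap ℝ E).rangeRestrictField_bijective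
  refine Algebra.finrank_eq_of_equiv_equiv ((e₁.trans e₂).trans e₃.symm) j ?_
  ext x
  have h : ((e₃ (e₃.symm (e₂ (e₁ x))) : (algebraMap ℝ E).fieldRange) : E) = j x := by
    rw [RingEquiv.apply_symm_apply]
    rfl
  exact h

/-- The local degree at an infinite place is `1 / [K : ℚ]` or `2 / [K : ℚ]`. -/
lemma localDegree_infinitePlace (w : InfinitePlace K) :
    localDegree w.1 = (w.mult : ℝ) / Module.finrank (⊥ : Subfield K) K := by
  have : CharZero K := inferInstance
  rw [localDegree, if_pos this]
  congr 2
  let e := (InfinitePlace.Completion.equiv w).symm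
  have he : Isometry e := (InfinitePlace.Completion.isometryEquivCompletion w).symm.isometry
  rcases w.isReal_or_isComplex with hw | hw
  · rw [finrank_topologicalClosure_bot_eq
      (e.trans (InfinitePlace.Completion.ringEquivRealOfIsReal hw))
      ((InfinitePlace.Completion.isometryEquivRealOfIsReal hw).isometry.comp he),
      InfinitePlace.mult, if_pos hw, Module.finrank_self]
  · rw [finrank_topologicalClosure_bot_eq
      (e.trans (InfinitePlace.Completion.ringEquivComplexOfIsComplex hw))
      ((InfinitePlace.Completion.isometryEquivComplexOfIsComplex hw).isometry.comp he),
      InfinitePlace.mult, if_neg (InfinitePlace.not_isReal_iff_isComplex.2 hw),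
      Complex.finrank_real_complex]

end Archimedean

/-! ### Local degrees at the finite places of a number field -/

lemma norm_sub_le_max_of_isUltrametricDist {L : Type*} [SeminormedAddCommGroup L]
    [IsUltrametricDist L] (x y : L) : ‖x - y‖ ≤ max ‖x‖ ‖y‖ := by
  simpa [sub_eq_add_neg] using IsUltrametricDist.norm_add_le_max x (-y)

/-- Finite-dimensional subspaces over a complete subfield are closed. -/
lemma isClosed_span_range {L : Type*} [NormedField L] [CompleteSpace L] (F : Subfield L)
    (hF : IsClosed (F : Set L)) (hx : ∃ x ∈ F, 1 < ‖x‖) {ι : Type*} [Finite ι] (f : ι → L) :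
    IsClosed (Submodule.span F (Set.range f) : Set L) := by
  let : NontriviallyNormedField F :=
    { (inferInstance : NormedField F) with
      non_trivial := by
        obtain ⟨x, hx, h⟩ := hx
        exact ⟨⟨x, hx⟩, h⟩ }
  have : CompleteSpace F := hF.completeSpace_coe
  let : NormedSpace F L := { norm_smul_le := fun a x ↦ (norm_mul _ _).le }
  have : FiniteDimensional F (Submodule.span F (Set.range f)) :=
    .span_of_finite _ (Set.finite_range _)
  exact Submodule.closed_of_finiteDimensional _

section PadicDegree

variable {K : Type*} [Field K] {v : AbsoluteValue K ℝ} {p : ℕ} [Fact p.Prime]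

/-- Lifts to `K` of a basis of the ring of integers of `K_v` modulo `p`: integral elements whose
integer combinations approximate every integral element of `K` to within `|p| = 1 / p`, in a way
that is unique modulo `p`. -/
structure IsBasisModP (v : AbsoluteValue K ℝ) (p : ℕ) {m : ℕ} (b : Fin m → K) : Prop where
  le_one : ∀ i, v (b i) ≤ 1
  exists_sub_le : ∀ x, v x ≤ 1 → ∃ a : Fin m → ℤ, v (x - ∑ i, (a i : K) * b i) ≤ (p : ℝ)⁻¹
  dvd_of_le : ∀ a : Fin m → ℤ, v (∑ i, (a i : K) * b i) ≤ (p : ℝ)⁻¹ → ∀ i, (p : ℤ) ∣ a i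

/-- A basis of a finite `𝔽_p`-vector space, with integers as coefficients. -/
lemma exists_intCast_basis (p : ℕ) [Fact p.Prime] (M : Type*) [AddCommGroup M] [Finite M]
    [Module (ZMod p) M] :
    ∃ (m : ℕ) (B : Fin m → M), Nat.card M = p ^ m ∧ (∀ x, ∃ a : Fin m → ℤ, x = ∑ i, a i • B i) ∧
      ∀ a : Fin m → ℤ, ∑ i, a i • B i = 0 → ∀ i, (p : ℤ) ∣ a i := by
  let B := Module.finBasis (ZMod p) M
  refine ⟨Module.finrank (ZMod p) M, B, ?_, fun x ↦ ?_, fun a ha i ↦ ?_⟩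
  · rw [Module.natCard_eq_pow_finrank (K := ZMod p) (V := M), Nat.card_zmod]
  · choose a ha using fun i ↦ ZMod.intCast_surjective (B.repr x i)
    refine ⟨a, ?_⟩
    simp_rw [← Int.cast_smul_eq_zsmul (ZMod p), ha]
    exact (B.sum_repr _).symm
  · simp_rw [← Int.cast_smul_eq_zsmul (ZMod p)] at ha
    exact (ZMod.intCast_zmod_eq_zero_iff_dvd _ _).1
      (Fintype.linearIndependent_iff.1 B.linearIndependent _ ha i)

/-- If `p` generates the `e`-th power of `P` locally, expressed by `e * β = log p`, then a basis of
`R / P ^ e` over `𝔽_p` lifts to a basis modulo `p`. -/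
lemma IsAdic.exists_isBasisModP {R : Type*} [CommRing R] [IsDedekindDomain R] [Algebra R K]
    [IsFractionRing R K] {P : HeightOneSpectrum R} {β : ℝ} (h : IsAdic v P β) {e : ℕ}
    (he : e * β = Real.log p) [Finite (R ⧸ P.asIdeal ^ e)] (hp : v p ≤ (p : ℝ)⁻¹) :
    ∃ (m : ℕ) (b : Fin m → K), Submodule.cardQuot (P.asIdeal ^ e) = p ^ m ∧ IsBasisModP v p b := by
  have hp0 : (0 : ℝ) < p := by exact_mod_cast (Fact.out : p.Prime).pos
  have hexp : Real.exp (-(e * β)) = (p : ℝ)⁻¹ := by rw [he, Real.exp_neg, Real.exp_log hp0]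
  have hmem : ∀ r : R, v (algebraMap R K r) ≤ (p : ℝ)⁻¹ ↔ r ∈ P.asIdeal ^ e := fun r ↦ by
    rw [← hexp, h.algebraMap_le_exp_iff]
  obtain ⟨m, B, hcard, hspan, hdvd⟩ := @exists_intCast_basis p _ (R ⧸ P.asIdeal ^ e) _ _
    (AddCommGroup.zmodModule fun x ↦ by
      obtain ⟨r, rfl⟩ := Ideal.Quotient.mk_surjective x
      rw [← map_nsmul, Ideal.Quotient.eq_zero_iff_mem, ← hmem, nsmul_eq_mul, map_mul, map_natCast,
        map_mul]
      exact (mul_le_of_le_one_right (v.nonneg _) (h.algebraMap_le_one r)).trans hp)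
  choose b hb using fun i ↦ Ideal.Quotient.mk_surjective (B i)
  have hsum : ∀ a : Fin m → ℤ,
      Ideal.Quotient.mk (P.asIdeal ^ e) (∑ i, (a i : R) * b i) = ∑ i, a i • B i := fun a ↦ by
    rw [map_sum]
    refine Finset.sum_congr rfl fun i _ ↦ ?_
    rw [map_mul, map_intCast, hb, zsmul_eq_mul]
  have hmap : ∀ a : Fin m → ℤ,
      ∑ i, (a i : K) * algebraMap R K (b i) = algebraMap R K (∑ i, (a i : R) * b i) := by
    simp
  refine ⟨m, fun i ↦ algebraMap R K (b i), hcard, fun i ↦ h.algebraMap_le_one _, fun x hx ↦ ?_,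
    fun a ha ↦ ?_⟩
  · obtain ⟨r, hr⟩ := h.exists_sub_le hx e
    obtain ⟨a, ha⟩ := hspan (Ideal.Quotient.mk _ r)
    refine ⟨a, ?_⟩
    have h1 : v (algebraMap R K (r - ∑ i, (a i : R) * b i)) ≤ (p : ℝ)⁻¹ := by
      rw [hmem, ← Ideal.Quotient.eq_zero_iff_mem, map_sub, hsum, ha, sub_self]
    rw [hmap, ← sub_add_sub_cancel x (algebraMap R K r), ← map_sub]
    exact (h.isNonarchimedean _ _).trans (max_le (hexp ▸ hr) h1)
  · rw [hmap, hmem, ← Ideal.Quotient.eq_zero_iff_mem, hsum] at ha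
    exact hdvd a ha

variable (hv : ∀ q : ℚ, v (q : K) = Rat.AbsoluteValue.padic p q)
include hv

lemma apply_intCast_le_one (n : ℤ) : v n ≤ 1 := by
  have := hv n
  rw [Rat.cast_intCast] at this
  exact this.trans_le (Rat.AbsoluteValue.padic_le_one p n)

lemma apply_prime : v p = (p : ℝ)⁻¹ := by
  have := hv p
  rw [Rat.cast_natCast] at this
  rw [this, Rat.AbsoluteValue.padic_eq_padicNorm, padicNorm.padicNorm_p_of_prime]
  simp

lemma isNonarchimedean_of_padic : IsNonarchimedean v :=
  isNonarchimedean_of_natCast_le_one v fun n ↦ by simpa using apply_intCast_le_one hv n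

/-- The integers are `1 / p`-dense in the unit ball of the closure of `ℚ` in `K_v`, a copy of
`ℤ_p`. -/
lemma exists_intCast_sub_le [CharZero K] {x : v.Completion}
    (hx : x ∈ (⊥ : Subfield v.Completion).topologicalClosure) (hx1 : ‖x‖ ≤ 1) :
    ∃ n : ℤ, ‖x - n‖ ≤ (p : ℝ)⁻¹ := by
  have hna := isNonarchimedean_of_padic hv
  have := isUltrametricDist_completion hna
  have hp : (0 : ℝ) < (p : ℝ)⁻¹ := inv_pos.2 (by exact_mod_cast (Fact.out : p.Prime).pos)
  have hp1 : (p : ℝ)⁻¹ ≤ 1 := inv_le_one_of_one_le₀ (by exact_mod_cast (Fact.out : p.Prime).pos)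
  obtain ⟨y, hy, hxy⟩ := Metric.mem_closure_iff.1 hx _ hp
  have hch : CharZero v.Completion := charZero_of_injective_ringHom (embed v).injective
  obtain ⟨q, rfl⟩ : y ∈ (Rat.castHom v.Completion).fieldRange :=
    (bot_le : (⊥ : Subfield v.Completion) ≤ _) hy
  rw [dist_eq_norm, Rat.coe_castHom] at hxy
  have hnorm : ∀ r : ℚ, ‖(r : v.Completion)‖ = ‖(r : ℚ_[p])‖ := fun r ↦ by
    rw [← map_ratCast (embed v), norm_embed, hv, Padic.eq_padicNorm]
    rfl
  have hq : ‖(q : ℚ_[p])‖ ≤ 1 := by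
    rw [← hnorm, ← sub_sub_cancel x (q : v.Completion)]
    exact (norm_sub_le_max_of_isUltrametricDist _ _).trans (max_le hx1 (hxy.le.trans hp1))
  obtain ⟨n, -, -, hn⟩ := PadicInt.exists_mem_range_of_norm_rat_le_one q hq
  refine ⟨n, ?_⟩
  have h1 : ‖((q - n : ℚ) : v.Completion)‖ ≤ (p : ℝ)⁻¹ := by
    rw [hnorm]
    have h2 : ‖((q - n : ℚ) : ℚ_[p])‖ < (p : ℝ) ^ (0 : ℤ) := by
      rw [zpow_zero]
      push_cast
      exact hn
    simpa using (Padic.norm_lt_pow_iff_norm_le_pow_sub_one _ _).1 h2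
  rw [← sub_add_sub_cancel x (q : v.Completion)]
  push_cast at h1
  exact (IsUltrametricDist.norm_add_le_max _ _).trans (max_le hxy.le h1)

/-- A relation over the closure of `ℚ`, scaled so that its largest coefficient is `1`, reduces to a
nontrivial relation modulo `p`. -/
lemma IsBasisModP.linearIndependent [CharZero K] {m : ℕ} {b : Fin m → K} (hb : IsBasisModP v p b) :
    LinearIndependent (⊥ : Subfield v.Completion).topologicalClosure fun i ↦ embed v (b i) := by
  have := isUltrametricDist_completion (isNonarchimedean_of_padic hv)
  have hp1 : (p : ℝ)⁻¹ < 1 := inv_lt_one_of_one_lt₀ (by exact_mod_cast (Fact.out : p.Prime).one_lt)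
  have hp0 : 0 ≤ (p : ℝ)⁻¹ := by positivity
  rw [Fintype.linearIndependent_iff]
  intro g hg
  by_contra! hne
  obtain ⟨i₀, hi₀⟩ := hne
  obtain ⟨j, -, hj⟩ := Finset.exists_max_image Finset.univ (fun i ↦ ‖g i‖) ⟨i₀, Finset.mem_univ _⟩
  have hj0 : g j ≠ 0 := norm_pos_iff.1 ((norm_pos_iff.2 hi₀).trans_le (hj i₀ (Finset.mem_univ _)))
  have hc : ∀ i, ‖((g i / g j :) : v.Completion)‖ ≤ 1 := fun i ↦ by
    rw [Subfield.coe_div, norm_div]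
    exact div_le_one_of_le₀ (hj i (Finset.mem_univ _)) (norm_nonneg _)
  choose n hn using fun i ↦ exists_intCast_sub_le hv (g i / g j).2 (hc i)
  have hzero : ∑ i, ((g i / g j :) : v.Completion) * embed v (b i) = 0 := by
    have h1 : ∑ i, ((g i / g j :) : v.Completion) * embed v (b i) =
        (g j : v.Completion)⁻¹ * ∑ i, g i • embed v (b i) := by
      rw [Finset.mul_sum]
      refine Finset.sum_congr rfl fun i _ ↦ ?_
      rw [Subfield.coe_div, div_eq_inv_mul, mul_assoc]
      rfl
    rw [h1, hg, mul_zero]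
  have hle : v (∑ i, (n i : K) * b i) ≤ (p : ℝ)⁻¹ := by
    have h1 : embed v (∑ i, (n i : K) * b i) =
        -∑ i, (((g i / g j :) : v.Completion) - n i) * embed v (b i) := by
      simp only [sub_mul, Finset.sum_sub_distrib, hzero, map_sum, map_mul, map_intCast]
      simp
    rw [← norm_embed, h1, norm_neg]
    refine IsUltrametricDist.norm_sum_le_of_forall_le_of_nonneg hp0 fun i _ ↦ ?_
    rw [norm_mul, norm_embed]
    exact (mul_le_of_le_one_right (norm_nonneg _) (hb.le_one i)).trans (hn i)
  obtain ⟨k, hk⟩ := hb.dvd_of_le n hle j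
  have h2 : ‖(n j : v.Completion)‖ ≤ (p : ℝ)⁻¹ := by
    rw [← map_intCast (embed v), norm_embed, hk]
    push_cast
    rw [map_mul, apply_prime hv]
    exact mul_le_of_le_one_right hp0 (apply_intCast_le_one hv k)
  have h3 := hn j
  rw [div_self hj0] at h3
  have h4 : ‖(1 : v.Completion)‖ ≤ (p : ℝ)⁻¹ := by
    rw [← sub_add_cancel (1 : v.Completion) (n j)]
    exact (IsUltrametricDist.norm_add_le_max _ _).trans (max_le h3 h2)
  rw [norm_one] at h4
  exact h4.not_gt hp1

/-- Successive approximation modulo powers of `p` puts the integers of `K_v` into the closure of the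
span, which is closed already. -/
lemma IsBasisModP.span_eq_top [CharZero K] {m : ℕ} {b : Fin m → K} (hb : IsBasisModP v p b) :
    Submodule.span (⊥ : Subfield v.Completion).topologicalClosure
      (Set.range fun i ↦ embed v (b i)) = ⊤ := by
  have := isUltrametricDist_completion (isNonarchimedean_of_padic hv)
  set F := (⊥ : Subfield v.Completion).topologicalClosure
  set V := Submodule.span F (Set.range fun i ↦ embed v (b i))
  have hpp : 1 < (p : ℝ) := by exact_mod_cast (Fact.out : p.Prime).one_lt
  have hp0 : 0 < (p : ℝ)⁻¹ := by positivity
  have hp1 : (p : ℝ)⁻¹ < 1 := inv_lt_one_of_one_lt₀ hpp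
  have hnp : ‖(p : v.Completion)‖ = (p : ℝ)⁻¹ := by
    rw [← apply_prime hv, ← norm_embed, map_natCast]
  have hpL : (p : v.Completion) ≠ 0 := norm_pos_iff.1 (hnp ▸ hp0)
  have hclosed : IsClosed (V : Set v.Completion) :=
    isClosed_span_range F (Subfield.isClosed_topologicalClosure _)
      ⟨(p : v.Completion)⁻¹, F.inv_mem (natCast_mem F p), by rwa [norm_inv, hnp, inv_inv]⟩ _
  -- approximation of an integer of `K_v` modulo `p`
  have step : ∀ y : v.Completion, ‖y‖ ≤ 1 → ∃ s ∈ V, ‖y - s‖ ≤ (p : ℝ)⁻¹ := by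
    intro y hy
    obtain ⟨x, hx⟩ := (denseRange_embed v).exists_dist_lt y hp0
    rw [dist_eq_norm] at hx
    have hx1 : v x ≤ 1 := by
      rw [← norm_embed, ← sub_sub_cancel y (embed v x)]
      exact (norm_sub_le_max_of_isUltrametricDist _ _).trans (max_le hy (hx.le.trans hp1.le))
    obtain ⟨a, ha⟩ := hb.exists_sub_le x hx1
    refine ⟨embed v (∑ i, (a i : K) * b i), ?_, ?_⟩
    · rw [map_sum]
      refine Submodule.sum_mem _ fun i _ ↦ ?_
      have h1 : embed v ((a i : K) * b i) = (a i : F) • embed v (b i) := by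
        rw [map_mul, map_intCast]
        rfl
      rw [h1]
      exact V.smul_mem _ (Submodule.subset_span ⟨i, rfl⟩)
    · rw [← sub_add_sub_cancel y (embed v x), ← map_sub]
      refine (IsUltrametricDist.norm_add_le_max _ _).trans (max_le hx.le ?_)
      rwa [norm_embed]
  have approx : ∀ (n : ℕ) (y : v.Completion), ‖y‖ ≤ 1 → ∃ s ∈ V, ‖y - s‖ ≤ (p : ℝ)⁻¹ ^ n := by
    intro n
    induction n with
    | zero => exact fun y hy ↦ ⟨0, V.zero_mem, by simpa using hy⟩
    | succ n ih =>
      intro y hy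
      obtain ⟨s, hs, hys⟩ := step y hy
      obtain ⟨t, ht, hyt⟩ := ih ((y - s) / p) (by
        rw [norm_div, hnp]
        exact div_le_one_of_le₀ hys hp0.le)
      refine ⟨s + (p : F) • t, V.add_mem hs (V.smul_mem _ ht), ?_⟩
      have h1 : y - (s + (p : F) • t) = p * ((y - s) / p - t) := by
        change y - (s + (p : v.Completion) * t) = _
        field_simp
        ring
      rw [h1, norm_mul, hnp, pow_succ']
      exact mul_le_mul_of_nonneg_left hyt hp0.le
  have unit : ∀ y : v.Completion, ‖y‖ ≤ 1 → y ∈ V := by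
    intro y hy
    refine hclosed.closure_subset (Metric.mem_closure_iff.2 fun ε hε ↦ ?_)
    obtain ⟨n, hn⟩ := exists_pow_lt_of_lt_one hε hp1
    obtain ⟨s, hs, hys⟩ := approx n y hy
    exact ⟨s, hs, by rw [dist_eq_norm]; exact hys.trans_lt hn⟩
  refine eq_top_iff.2 fun y _ ↦ ?_
  obtain ⟨k, hk⟩ := pow_unbounded_of_one_lt ‖y‖ hpp
  have h1 : y = ((p : F) ^ k)⁻¹ • ((p : v.Completion) ^ k * y) := by
    change y = ((p : v.Completion) ^ k)⁻¹ * ((p : v.Completion) ^ k * y)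
    rw [inv_mul_cancel_left₀ (pow_ne_zero _ hpL)]
  rw [h1]
  refine V.smul_mem _ (unit _ ?_)
  rw [norm_mul, norm_pow, hnp, inv_pow, inv_mul_le_iff₀ (by positivity), mul_one]
  exact hk.le

lemma IsBasisModP.finrank_eq [CharZero K] {m : ℕ} {b : Fin m → K} (hb : IsBasisModP v p b) :
    Module.finrank (⊥ : Subfield v.Completion).topologicalClosure v.Completion = m := by
  have := Module.finrank_eq_card_basis
    (Module.Basis.mk (hb.linearIndependent hv) (hb.span_eq_top hv).ge)
  simpa using this

end PadicDegree

/-! ### The product formula for number fields -/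

section PadicUnique

variable {K : Type*} [Field K] [CharZero K] {v : AbsoluteValue K ℝ} {p : ℕ} [Fact p.Prime]

lemma prime_inv_lt_one (p : ℕ) [Fact p.Prime] : (p : ℝ)⁻¹ < 1 :=
  inv_lt_one_of_one_lt₀ (by exact_mod_cast (Fact.out : p.Prime).one_lt)

/-- A nonarchimedean absolute value with `|p| = 1/p` extends the `p`-adic one: on `ℚ` both belong to
the prime ideal `(p)` of `ℤ`. -/
lemma eq_padic_of_apply_prime (hna : IsNonarchimedean v) (hp : v p = (p : ℝ)⁻¹) (q : ℚ) :
    v q = Rat.AbsoluteValue.padic p q := by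
  let w : AbsoluteValue ℚ ℝ := v.comp (f := Rat.castHom K) (Rat.castHom K).injective
  have hw : ∀ q : ℚ, w q = v q := fun q ↦ rfl
  have hpp : Rat.AbsoluteValue.padic p (p : ℚ) = (p : ℝ)⁻¹ :=
    apply_prime (v := Rat.AbsoluteValue.padic p) fun q ↦ by simp
  have hex : ∀ u : AbsoluteValue ℚ ℝ, IsNonarchimedean u → u p = (p : ℝ)⁻¹ →
      ∃ (P : HeightOneSpectrum ℤ) (β : ℝ), IsAdic u P β ∧ (p : ℤ) ∈ P.asIdeal := by
    intro u hu hup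
    have hlt : u (algebraMap ℤ ℚ p) < 1 := by
      simpa [hup] using prime_inv_lt_one p
    obtain ⟨P, β, h⟩ := exists_isAdic (R := ℤ) hu (fun r ↦ hu.apply_intCast_le_one)
      ⟨p, by exact_mod_cast (Fact.out : p.Prime).ne_zero, hlt⟩
    exact ⟨P, β, h, (h.algebraMap_lt_one_iff _).1 hlt⟩
  have hmax : (Ideal.span {(p : ℤ)}).IsMaximal :=
    PrincipalIdealRing.isMaximal_of_irreducible
      (Nat.prime_iff_prime_int.1 (Fact.out : p.Prime)).irreducible
  obtain ⟨P₁, β₁, h₁, hp₁⟩ := hex w (fun a b ↦ by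
    simpa [hw] using hna (a : K) (b : K)) (by rw [hw, Rat.cast_natCast, hp])
  obtain ⟨P₂, β₂, h₂, hp₂⟩ := hex (Rat.AbsoluteValue.padic p)
    (isNonarchimedean_of_padic (p := p) fun q ↦ by simp) hpp
  have hP : ∀ P : HeightOneSpectrum ℤ, (p : ℤ) ∈ P.asIdeal → Ideal.span {(p : ℤ)} = P.asIdeal :=
    fun P hP ↦ hmax.eq_of_le P.isPrime.ne_top ((Ideal.span_singleton_le_iff_mem _).2 hP)
  obtain rfl : P₁ = P₂ := HeightOneSpectrum.ext ((hP P₁ hp₁).symm.trans (hP P₂ hp₂))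
  have hp0 : (p : ℚ) ≠ 0 := by exact_mod_cast (Fact.out : p.Prime).ne_zero
  have e₁ := h₁.log_eq p hp0
  have e₂ := h₂.log_eq p hp0
  rw [hpp] at e₂
  rw [hw, Rat.cast_natCast, hp, e₂] at e₁
  have hne : ((WithZero.log (P₁.valuation ℚ p) : ℤ) : ℝ) ≠ 0 := fun h0 ↦ by
    rw [h0, zero_mul] at e₂
    exact (Real.log_neg (by have := (Fact.out : p.Prime).pos; positivity)
      (prime_inv_lt_one p)).ne e₂
  obtain rfl := mul_left_cancel₀ hne e₁
  rw [← hw, h₁.ext h₂]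

end PadicUnique

variable {K : Type*} [Field K] [NumberField K]

section FinitePlaces

variable {v : AbsoluteValue K ℝ} {p : ℕ} [Fact p.Prime] {P : HeightOneSpectrum (𝓞 K)} {β : ℝ}

/-- An extension of a `p`-adic absolute value to a number field belongs to a prime. -/
lemma exists_isAdic_of_padic (hv : ∀ q : ℚ, v (q : K) = Rat.AbsoluteValue.padic p q) :
    ∃ (P : HeightOneSpectrum (𝓞 K)) (β : ℝ), IsAdic v P β := by
  have hna := isNonarchimedean_of_padic hv
  refine exists_isAdic hna (fun r ↦ le_one_of_isIntegral (A := ℤ) hna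
    (fun a ↦ apply_intCast_le_one hv a) r.isIntegral_coe) ⟨p, ?_, ?_⟩
  · exact_mod_cast (Fact.out : p.Prime).ne_zero
  · rw [map_natCast, apply_prime hv]
    exact prime_inv_lt_one p

/-- The normalization of `v` in terms of the ramification index: `e * β = log p`. -/
lemma IsAdic.multiplicity_mul_eq_log (h : IsAdic v P β)
    (hv : ∀ q : ℚ, v (q : K) = Rat.AbsoluteValue.padic p q) :
    multiplicity P.asIdeal (Ideal.span {(p : 𝓞 K)}) * β = Real.log p := by
  have hp0 : (p : 𝓞 K) ≠ 0 := by exact_mod_cast (Fact.out : p.Prime).ne_zero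
  have h1 := h.log_eq (algebraMap (𝓞 K) K p) (by simpa using hp0)
  rw [log_valuation_algebraMap P hp0, map_natCast, apply_prime hv, Real.log_inv] at h1
  push_cast at h1
  linarith

lemma log_prime_pos (p : ℕ) [Fact p.Prime] : 0 < Real.log p :=
  Real.log_pos (by exact_mod_cast (Fact.out : p.Prime).one_lt)

/-- The local degree `[K_v : ℚ_p]` is the product `e * f` of the ramification index and the residue
degree, in the form `[K_v : ℚ_p] * β = f * log p` with `e * β = log p`. -/
lemma IsAdic.finrank_mul_eq_log (h : IsAdic v P β)
    (hv : ∀ q : ℚ, v (q : K) = Rat.AbsoluteValue.padic p q) :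
    Module.finrank (⊥ : Subfield v.Completion).topologicalClosure v.Completion * β =
      Real.log (Ideal.absNorm P.asIdeal) := by
  set e := multiplicity P.asIdeal (Ideal.span {(p : 𝓞 K)})
  have he : e * β = Real.log p := h.multiplicity_mul_eq_log hv
  have : Finite (𝓞 K ⧸ P.asIdeal ^ e) :=
    Ideal.finiteQuotientOfFreeOfNeBot _ (pow_ne_zero _ P.ne_bot)
  obtain ⟨m, b, hm, hb⟩ := h.exists_isBasisModP he (apply_prime hv).le
  rw [hb.finrank_eq hv]
  rw [← Ideal.absNorm_apply, map_pow] at hm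
  have hlog := congrArg (fun n : ℕ ↦ Real.log n) hm
  simp only [Nat.cast_pow, Real.log_pow] at hlog
  have he0 : (e : ℝ) ≠ 0 := fun h0 ↦ by
    rw [h0, zero_mul] at he
    exact (log_prime_pos p).ne he
  refine mul_left_cancel₀ he0 ?_
  rw [hlog, ← he]
  ring

/-- The local degree turns the absolute value extending `|·|_p` into the one normalized by the norm
of the prime. -/
lemma IsAdic.localDegree_mul_log (h : IsAdic v P β)
    (hv : ∀ q : ℚ, v (q : K) = Rat.AbsoluteValue.padic p q) {x : K} (hx : x ≠ 0) :
    localDegree v * Real.log (v x) =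
      Real.log (FinitePlace.mk P x) / Module.finrank (⊥ : Subfield K) K := by
  have : CharZero K := inferInstance
  have h1 : Real.log (FinitePlace.mk P x) =
      WithZero.log (P.valuation K x) * Real.log (Ideal.absNorm P.asIdeal) := by
    rw [FinitePlace.mk_apply, FinitePlace.norm_embedding]
    exact (isAdic_adicAbv P (HeightOneSpectrum.one_lt_absNorm_nnreal P)).log_eq x hx
  rw [localDegree, if_pos this, h1, ← h.finrank_mul_eq_log hv, h.log_eq x hx]
  ring

/-- The prime lies above only one `p`, and the ramification index fixes the normalization. -/
lemma IsAdic.eq_of_padic (h : IsAdic v P β)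
    (hv : ∀ q : ℚ, v (q : K) = Rat.AbsoluteValue.padic p q)
    {v' : AbsoluteValue K ℝ} {p' : ℕ} [Fact p'.Prime] {β' : ℝ} (h' : IsAdic v' P β')
    (hv' : ∀ q : ℚ, v' (q : K) = Rat.AbsoluteValue.padic p' q) : v = v' := by
  have hmem : (p' : 𝓞 K) ∈ P.asIdeal := by
    rw [← h'.algebraMap_lt_one_iff, map_natCast, apply_prime hv']
    exact prime_inv_lt_one p'
  rw [← h.algebraMap_lt_one_iff, map_natCast, ← Rat.cast_natCast, hv,
    Rat.AbsoluteValue.padic_eq_padicNorm] at hmem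
  obtain rfl : p = p' := by
    by_contra hne
    have := padicNorm.padicNorm_of_prime_of_ne hne
    rw [this] at hmem
    simp at hmem
  have h1 := (h.multiplicity_mul_eq_log hv).trans (h'.multiplicity_mul_eq_log hv').symm
  have he0 : (multiplicity P.asIdeal (Ideal.span {(p : 𝓞 K)}) : ℝ) ≠ 0 := fun h0 ↦ by
    have := h.multiplicity_mul_eq_log hv
    rw [h0, zero_mul] at this
    exact (log_prime_pos p).ne this
  obtain rfl := mul_left_cancel₀ he0 h1
  exact h.ext h'

/-- Every prime of `𝓞 K` carries an absolute value extending a `p`-adic one, where `p` is the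
residue characteristic. -/
lemma exists_padic_isAdic (P : HeightOneSpectrum (𝓞 K)) :
    ∃ (p : ℕ) (_ : Fact p.Prime) (v : AbsoluteValue K ℝ) (β : ℝ), IsAdic v P β ∧
      ∀ q : ℚ, v (q : K) = Rat.AbsoluteValue.padic p q := by
  have : Finite (𝓞 K ⧸ P.asIdeal) := Ideal.finiteQuotientOfFreeOfNeBot _ P.ne_bot
  obtain ⟨p, hp⟩ := CharP.exists (𝓞 K ⧸ P.asIdeal)
  have hprime : Fact p.Prime := ⟨CharP.char_is_prime (𝓞 K ⧸ P.asIdeal) p⟩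
  have hmem : (p : 𝓞 K) ∈ P.asIdeal := by
    rw [← Ideal.Quotient.eq_zero_iff_mem, map_natCast, CharP.cast_eq_zero]
  have hp0 : (p : 𝓞 K) ≠ 0 := by exact_mod_cast hprime.out.ne_zero
  set e := multiplicity P.asIdeal (Ideal.span {(p : 𝓞 K)}) with he
  have he0 : (0 : ℝ) < e := by
    have : e ≠ 0 := fun h0 ↦ by
      rw [he, multiplicity_eq_zero, Ideal.dvd_span_singleton] at h0
      exact h0 hmem
    exact_mod_cast Nat.pos_of_ne_zero this
  obtain ⟨v, hv⟩ := exists_isAdic_of_pos (K := K) P (div_pos (log_prime_pos p) he0)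
  refine ⟨p, hprime, v, _, hv, eq_padic_of_apply_prime hv.isNonarchimedean ?_⟩
  have hpK : (p : K) ≠ 0 := by exact_mod_cast hprime.out.ne_zero
  have h1 := hv.log_eq (algebraMap (𝓞 K) K p) (by simpa using hp0)
  rw [log_valuation_algebraMap P hp0, map_natCast, ← he] at h1
  have h2 : Real.log (v p) = Real.log (p : ℝ)⁻¹ := by
    rw [h1, Real.log_inv]
    push_cast
    field_simp
  have hpR : (0 : ℝ) < p := by exact_mod_cast hprime.out.pos
  exact Real.log_injOn_pos (v.pos hpK) (inv_pos.2 hpR) h2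

end FinitePlaces

/-- Infinite places extend the real absolute value. -/
lemma infinitePlace_mem_places (w : InfinitePlace K) : w.1 ∈ places K := by
  refine Or.inl ⟨inferInstance, Rat.AbsoluteValue.real, Or.inl rfl, fun q ↦ ?_⟩
  have := w.norm_embedding_eq (q : K)
  rw [map_ratCast] at this
  rw [Rat.AbsoluteValue.real_eq_abs]
  refine this.symm.trans ?_
  rw [← Complex.ofReal_ratCast, Complex.norm_real, Real.norm_eq_abs, Rat.cast_abs]

/-- Under the identification of `places K` with Mathlib's infinite and finite places, the local
degree times the logarithm is, up to the factor `[K : ℚ]`, the logarithm of the normalized absolute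
value. -/
lemma exists_maps_to_places (K : Type*) [Field K] [NumberField K] :
    ∃ (f : InfinitePlace K → places K) (g : FinitePlace K → places K),
      Function.Injective f ∧ Function.Injective g ∧ Disjoint (Set.range f) (Set.range g) ∧
      Set.range f ∪ Set.range g = Set.univ ∧
      (∀ w, IsNonarchimedean (g w).1) ∧
      (∀ w (x : K), x ≠ 0 → localDegree (f w).1 * Real.log ((f w).1 x) =
        w.mult * Real.log (w x) / Module.finrank (⊥ : Subfield K) K) ∧
      (∀ w (x : K), x ≠ 0 → localDegree (g w).1 * Real.log ((g w).1 x) =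
        Real.log (w x) / Module.finrank (⊥ : Subfield K) K) ∧
      ∀ w (x : K), x ≠ 0 → ((g w).1 x = 1 ↔ w x = 1) := by
  choose p hp v β hv hvp using exists_padic_isAdic (K := K)
  have hvmem : ∀ P, v P ∈ places K := fun P ↦
    Or.inl ⟨inferInstance, _, Or.inr ⟨p P, hp P, rfl⟩, hvp P⟩
  have hlog : ∀ w : FinitePlace K, ∀ x : K, x ≠ 0 →
      localDegree (v w.maximalIdeal) * Real.log (v w.maximalIdeal x) =
        Real.log (w x) / Module.finrank (⊥ : Subfield K) K := fun w x hx ↦ by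
    have := (hv w.maximalIdeal).localDegree_mul_log (hvp w.maximalIdeal) hx
    rwa [FinitePlace.mk_maximalIdeal] at this
  refine ⟨fun w ↦ ⟨w.1, infinitePlace_mem_places w⟩,
    fun w ↦ ⟨v w.maximalIdeal, hvmem _⟩, fun w w' h ↦ Subtype.ext (Subtype.mk.inj h),
    fun w w' h ↦ ?_, ?_, ?_, fun w ↦ (hv w.maximalIdeal).isNonarchimedean, fun w x hx ↦ ?_, hlog,
    fun w x hx ↦ ?_⟩
  · have h' : v w.maximalIdeal = v w'.maximalIdeal := congrArg Subtype.val h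
    exact FinitePlace.maximalIdeal_injective
      ((hv w.maximalIdeal).eq_of_isAdic (h' ▸ hv w'.maximalIdeal))
  · rw [Set.disjoint_left]
    rintro _ ⟨w, rfl⟩ ⟨w', h⟩
    have h' : v w'.maximalIdeal = w.1 := congrArg Subtype.val h
    have h2 := (isNonarchimedean_of_padic (hvp w'.maximalIdeal)).apply_natCast_le_one (n := 2)
    rw [h'] at h2
    have h3 := w.norm_embedding_eq 2
    rw [map_ofNat] at h3
    have h4 : w.1 ((2 : ℕ) : K) = 2 := by
      push_cast
      exact h3.symm.trans (by simp)
    rw [h4] at h2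
    norm_num at h2
  · refine Set.eq_univ_of_forall fun u ↦ ?_
    obtain ⟨u, ⟨-, w, hw | ⟨q, hq, hw⟩, huw⟩ | ⟨hK, -⟩⟩ := u
    · obtain ⟨w', rfl⟩ := exists_infinitePlace_eq (v := u) fun q ↦ by
        rw [huw, hw, Rat.AbsoluteValue.real_eq_abs, Rat.cast_abs]
      exact Or.inl ⟨w', rfl⟩
    · subst hw
      obtain ⟨P, γ, h⟩ := exists_isAdic_of_padic huw
      refine Or.inr ⟨FinitePlace.mk P, Subtype.ext ?_⟩
      change v (FinitePlace.mk P).maximalIdeal = u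
      rw [FinitePlace.maximalIdeal_mk]
      have := hp P
      exact (hv P).eq_of_padic (hvp P) h huw
    · exact absurd (inferInstance : CharZero K) hK
  · change localDegree w.1 * Real.log (w x) = _
    rw [localDegree_infinitePlace]
    ring
  · have h1 : Real.log (w x) = WithZero.log (w.maximalIdeal.valuation K x) *
        Real.log (Ideal.absNorm w.maximalIdeal.asIdeal) := by
      rw [← FinitePlace.norm_embedding_eq, FinitePlace.norm_embedding]
      exact (isAdic_adicAbv w.maximalIdeal
        (HeightOneSpectrum.one_lt_absNorm_nnreal w.maximalIdeal)).log_eq x hx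
    have h2 := (hv w.maximalIdeal).log_eq x hx
    have hN : Real.log (Ideal.absNorm w.maximalIdeal.asIdeal) ≠ 0 := (Real.log_pos (by
      exact_mod_cast HeightOneSpectrum.one_lt_absNorm w.maximalIdeal)).ne'
    have hlog1 : ∀ t : ℝ, 0 < t → (t = 1 ↔ Real.log t = 0) := fun t ht ↦
      ⟨fun h ↦ h ▸ Real.log_one, Real.eq_one_of_pos_of_log_eq_zero ht⟩
    change v w.maximalIdeal x = 1 ↔ _
    rw [hlog1 _ ((v w.maximalIdeal).pos hx), hlog1 _ (FinitePlace.pos_iff.2 hx), h1, h2,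
      mul_eq_zero, mul_eq_zero, or_iff_left (hv w.maximalIdeal).pos.ne', or_iff_left hN]

/-- The product formula `NumberField.prod_abs_eq_one`, with its exponents expressed by local
degrees. -/
theorem hasProductFormula_of_numberField (K : Type*) [Field K] [NumberField K] :
    HasProductFormula K := by
  obtain ⟨f, g, hf, hg, hdisj, huniv, hna, hlogf, hlogg, hone⟩ := exists_maps_to_places K
  have hfin : ∀ x : K, x ≠ 0 → {v : places K | v.1 x ≠ 1}.Finite := fun x hx ↦ by
    have h1 : {w : FinitePlace K | w x ≠ 1}.Finite := FinitePlace.hasFiniteMulSupport hx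
    refine ((Set.finite_range f).union (h1.image g)).subset fun u hu ↦ ?_
    have := huniv.ge (Set.mem_univ u)
    rcases this with h | ⟨w, rfl⟩
    · exact Or.inl h
    · exact Or.inr ⟨w, fun h ↦ hu ((hone w x hx).2 h), rfl⟩
  refine ⟨hfin, ?_, fun x hx ↦ ?_⟩
  · refine (Set.finite_range f).subset fun u hu ↦ ?_
    rcases huniv.ge (Set.mem_univ u) with h | ⟨w, rfl⟩
    · exact h
    · exact absurd (hna w) hu
  · set F : places K → ℝ := fun u ↦ localDegree u.1 * Real.log (u.1 x) with hF
    have hsupp : F.support.Finite := (hfin x hx).subset fun u hu h1 ↦ hu (by simp [hF, h1])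
    have h1 : {w : FinitePlace K | w x ≠ 1}.Finite := FinitePlace.hasFiniteMulSupport hx
    have hprod := congrArg Real.log (prod_abs_eq_one hx)
    rw [finprod_eq_prod _ h1, Real.log_mul, Real.log_prod, Real.log_prod, Real.log_one] at hprod
    · rw [← finsum_mem_univ, ← huniv, finsum_mem_union' hdisj (hsupp.subset Set.inter_subset_right)
        (hsupp.subset Set.inter_subset_right), finsum_mem_range hf, finsum_mem_range hg]
      simp only [hF]
      rw [finsum_congr fun w ↦ hlogf w x hx, finsum_congr fun w ↦ hlogg w x hx,
        finsum_eq_sum_of_fintype, finsum_eq_sum_of_support_subset _ (s := h1.toFinset),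
        ← Finset.sum_div, ← Finset.sum_div, ← add_div, div_eq_zero_iff]
      · left
        rw [← hprod]
        congr 1
        refine Finset.sum_congr rfl fun w _ ↦ ?_
        rw [Real.log_pow]
      · intro w hw
        simp only [Set.Finite.coe_toFinset, Set.mem_ofPred_eq]
        intro h
        exact hw (by simp [h])
    · exact fun w _ ↦ (FinitePlace.pos_iff.2 hx).ne'
    · exact fun w _ ↦ pow_ne_zero _ (InfinitePlace.pos_iff.2 hx).ne'
    · exact Finset.prod_ne_zero_iff.2 fun w _ ↦ pow_ne_zero _ (InfinitePlace.pos_iff.2 hx).ne'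
    · exact Finset.prod_ne_zero_iff.2 fun w _ ↦ (FinitePlace.pos_iff.2 hx).ne'

end StochasticHeight

theorem corollary4p4 {K : Type*} [Field K] (hK : IsGlobalField K)
    (e : ℕ) (E : MvPolynomial (Fin 2) K) (hE : E.IsHomogeneous e)
    (S : Set (Endomorphism K)) (hS : S.Finite) (hdeg : ∀ φ ∈ S, 2 ≤ φ.degree)
    (F : S → Lift K) (hF : ∀ φ : S, (F φ).IsLiftOf φ)
    [MeasurableSpace S] [DiscreteMeasurableSpace S]
    (ν₁ : Measure S) [IsProbabilityMeasure ν₁] :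
    -- (1) the local expected canonical heights are well defined
    (∀ v ∈ places K, ∀ P : P1 v.Completion, E.eval₂ (embed v) P.rep ≠ 0 →
      (∀ (γ : ℕ → S) (z : Fin 2 → v.Completion) (hz : z ≠ 0),
        P = Projectivization.mk v.Completion z hz →
          (∃ L : ℝ, Tendsto (greenSeq v (fun n ↦ F (γ n)) z) atTop (nhds L)) ∧
          localHeight v (fun n ↦ F (γ n)) e E P = localHeightAt v (fun n ↦ F (γ n)) e E z) ∧
      Integrable (fun γ : ℕ → S ↦ localHeight v (fun n ↦ F (γ n)) e E P) (iid ν₁)) ∧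
    -- (2) decomposition of the (well defined) expected canonical height as a finite sum
    (0 < e → ∀ P : P1 K, MvPolynomial.eval P.rep E ≠ 0 →
      (∀ γ : ℕ → S, ∃ L : ℝ,
        Tendsto (heightSeq (fun n ↦ (γ n : Endomorphism K)) P) atTop (nhds L)) ∧
      Integrable (fun γ : ℕ → S ↦ canonicalHeight (fun n ↦ (γ n : Endomorphism K)) P) (iid ν₁) ∧
      {v : places K | localDegree v.1 *
        expectedLocalHeight ν₁ F e E v.1 (P1.baseChange (embed v.1) P) ≠ 0}.Finite ∧
      expectedHeight ν₁ P = (1 / (e : ℝ)) * ∑ᶠ v : places K, localDegree v.1 *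
        expectedLocalHeight ν₁ F e E v.1 (P1.baseChange (embed v.1) P)) := by
  have hprod : HasProductFormula K := by
    obtain _ | ⟨p, _, _, _⟩ := hK
    · exact hasProductFormula_of_numberField K
    · exact hasProductFormula_of_ratFunc p
  have : Finite S := hS.to_subtype
  have : IsProbabilityMeasure (iid ν₁) := by
    unfold iid
    infer_instance
  have hd : ∀ φ : S, 2 ≤ (F φ).degree := fun φ ↦ (hF φ).1 ▸ hdeg φ φ.2
  exact ⟨fun v _ P hP ↦ integrable_localHeight e E hE F hd (iid ν₁) v P hP,
    fun he P hP ↦ expectedHeight_eq_of_hasProductFormula hprod e E hE S hS hdeg F hF ν₁ he P hP⟩
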